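/- There are absolute constants $K, C > 0$ such that the following holds. Let $P$ be a probability distribution on $\mathbb{R}^d$ with finite second moment, mean $\mu$ and covariance matrix $\Sigma$, and let $S$ be a multiset of $n$ i.i.d. samples from $P$. Let $\epsilon \ge 0$, $0 < \tau < 1$, and let $T$ be an $\epsilon$-corruption of $S$: an adversary who has inspected $S$ removes up to $\epsilon n$ of the points and replaces them by equally many arbitrary points. Let $\epsilon'$ satisfy $K(\epsilon + \log(1/\tau)/n) \le \epsilon' \le 1$, and suppose that $k = \lfloor \epsilon' n \rfloor \ge 1$. List $T$ in an arbitrary order, possibly chosen by the adversary, apply a uniformly random permutation that is independent of $S$ and of the listed $T$, split the first $k\lfloor n/k\rfloor$ points into $k$ consecutive buckets of size $\lfloor n/k \rfloor$ (discarding the remaining points), and let $T_k$ be the multiset of the $k$ bucket means. Then, with probability at least $1-\tau$, $T_k$ is a $0.01$-corruption of a multiset $S_k$ of $k$ points for which there is $S_k' \subseteq S_k$ with $|S_k'| \ge 0.95\,k$ such that $S_k'$ is $(0.1, \delta)$-stable with respect to $\mu$ and $k\|\Sigma\|/n$, where $$\delta = C\left(\sqrt{\operatorname{r}(\Sigma)/k}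 + 1\right).$$ Here $\|\Sigma\|$ is the spectral norm and $\operatorname{r}(\Sigma) = \operatorname{tr}(\Sigma)/\|\Sigma\|$ is the stable rank (read as $0$ if $\Sigma = 0$). For $0<\alpha<1/2$ and $\delta \ge \alpha$, a finite multiset $R$ is $(\alpha,\delta)$-stable with respect to $\mu$ and $\sigma^2$ if every $R' \subseteq R$ with $|R'| \ge (1-\alpha)|R|$ satisfies $$\Big\|\tfrac{1}{|R'|}\sum_{x\in R'} x - \mu\Big\| \le \sigma\delta \quad\text{and}\quad \Big\|\tfrac{1}{|R'|}\sum_{x\in R'}(x-\mu)(x-\mu)^T - \sigma^2 I\Big\| \le \sigma^2\delta^2/\alpha .$$ -/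

import Mathlib

open MeasureTheory ProbabilityTheory

noncomputable section

namespace MoMStability

/-- `ℝ^d` with the Euclidean norm. -/
abbrev Vec (d : ℕ) : Type := EuclideanSpace ℝ (Fin d)

/-- The spectral norm of a square real matrix: the operator norm of the linear map it induces
on Euclidean space. -/
def specNorm {d : ℕ} (M : Matrix (Fin d) (Fin d) ℝ) : ℝ :=
  ‖Matrix.toEuclideanCLM (n := Fin d) (𝕜 := ℝ) M‖

/-- The stable rank `tr M / ‖M‖` (equal to `0` for the zero matrix). -/
def stableRank {d : ℕ} (M : Matrix (Fin d) (Fin d) ℝ) : ℝ :=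
  M.trace / specNorm M

/-- The covariance matrix of a distribution on `ℝ^d`. -/
def covMat {d : ℕ} (P : Measure (Vec d)) : Matrix (Fin d) (Fin d) ℝ :=
  Matrix.of fun i j => covariance (fun x : Vec d => x i) (fun x : Vec d => x j) P

/-- The mean of a finite multiset of points. -/
def msMean {d : ℕ} (S : Multiset (Vec d)) : Vec d :=
  (S.card : ℝ)⁻¹ • S.sum

/-- The second moment matrix of a finite multiset of points, centered at `μ`. -/
def secondMoment {d : ℕ} (μ : Vec d) (S : Multiset (Vec d)) : Matrix (Fin d) (Fin d) ℝ :=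
  (S.card : ℝ)⁻¹ • (S.map fun x => Matrix.vecMulVec (x - μ).ofLp (x - μ).ofLp).sum

/-- `S` is `(ε, δ)`-stable with respect to the mean `μ` and the variance parameter
`v = σ²`. -/
def IsStableSet {d : ℕ} (ε δ : ℝ) (μ : Vec d) (v : ℝ) (S : Multiset (Vec d)) : Prop :=
  0 < ε ∧ ε < 1 / 2 ∧ ε ≤ δ ∧
    ∀ S' ≤ S, (1 - ε) * (S.card : ℝ) ≤ (S'.card : ℝ) →
      ‖msMean S' - μ‖ ≤ Real.sqrt v * δ ∧
      specNorm (secondMoment μ S' - v • (1 : Matrix (Fin d) (Fin d) ℝ)) ≤ v * δ ^ 2 / ε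

/-- `T` is an `ε`-corruption of `S`: up to `ε |S|` points of `S` are removed and replaced by
equally many arbitrary points. -/
def IsCorruption {E : Type*} (ε : ℝ) (S T : Multiset E) : Prop :=
  ∃ U R A : Multiset E, S = U + R ∧ T = U + A ∧ A.card = R.card ∧
    (R.card : ℝ) ≤ ε * (S.card : ℝ)

/-- The multiset of the entries of a tuple. -/
def toMultiset {E : Type*} {n : ℕ} (x : Fin n → E) : Multiset E :=
  Finset.univ.val.map x

theorem bucket_index_lt {n k : ℕ} (b : Fin k) (j : Fin (n / k)) :
    b.val * (n / k) + j.val < n := by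
  have hb : b.val + 1 ≤ k := b.isLt
  calc b.val * (n / k) + j.val < b.val * (n / k) + n / k := Nat.add_lt_add_left j.isLt _
    _ = (b.val + 1) * (n / k) := by ring
    _ ≤ k * (n / k) := Nat.mul_le_mul_right _ hb
    _ ≤ n := Nat.mul_div_le n k

/-- The mean of the `b`-th of `k` consecutive buckets of size `⌊n / k⌋` of a tuple of length
`n`; the last `n - k ⌊n / k⌋` entries are discarded. -/
def bucketMean {d n : ℕ} (k : ℕ) (w : Fin n → Vec d) (b : Fin k) : Vec d :=
  ((n / k : ℕ) : ℝ)⁻¹ • ∑ j : Fin (n / k), w ⟨b.val * (n / k) + j.val, bucket_index_lt b j⟩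

/-- Median-of-means preprocessing: shuffle the data by `σ`, split it into `k` buckets of equal
size and output the multiset of the `k` bucket means. -/
def momPreprocess {d n : ℕ} (k : ℕ) (t : Fin n → Vec d) (σ : Equiv.Perm (Fin n)) :
    Multiset (Vec d) :=
  toMultiset (bucketMean k fun i => t (σ i))

/-- Permutations of `{1, …, n}` carry the discrete σ-algebra. -/
instance instMeasurableSpacePerm (n : ℕ) : MeasurableSpace (Equiv.Perm (Fin n)) := ⊤

end MoMStability

end

open MoMStability

/-! Let z_b be the centered mean of the clean bucket b, an average of m = ⌊n/k⌋ points. The core is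
to discard at most 5% of the z_b so that the rest satisfy ∑ ⟪y, z_b⟫² ≤ 4 q² k ‖y‖² for every y,
with q² of order (‖Σ‖ + tr Σ / k) / m. Such a bound survives passing to a 90% subset, up to a
constant, and gives both stability inequalities by Cauchy–Schwarz
(`isStableSet_of_sum_inner_sq_le`).

With two moments only, Chebyshev handles one direction at a time. Uniformity over directions comes
from a PAC-Bayes argument (`measure_exists_card_large_inner_gt_le`): a direction u is smeared by a
Gaussian, at an entropy cost ‖u‖²/2, and the smearing adds tr Σ to the variance. Hence, with high
probability, every unit direction has only a small fraction of projections larger than q.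

The outliers still depend on the direction. Random signs extend the count from directions to all
quadratic forms of trace at most one (`card_large_listQuad_le`). That family is convex, so a minimax
theorem exchanges the quantifiers and gives one system of weights for all forms (`exists_weights`);
thresholding the weights at 1/2 gives one set of buckets (`exists_finset_sum_inner_sq_le`).

The adversary is removed separately. Each modified point spoils at most one bucket, and an
independent uniform shuffle makes any data-dependent ordering irrelevant, because composing with a
fixed permutation is injective on permutations (`measure_corrupted_le`). -/

/-! ### Gaussian translates and the Gibbs variational inequality. -/

section Gaussian

open scoped RealInnerProductSpace

/-- The Lebesgue density of the standard Gaussian measure. -/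
noncomputable def gaussianDensity {E : Type*} [NormedAddCommGroup E] [InnerProductSpace ℝ E]
    (x : E) : ℝ :=
  ((2 * Real.pi) ^ (Module.finrank ℝ E / 2 : ℝ))⁻¹ * Real.exp (-(1 / 2) * ‖x‖ ^ 2)

lemma gaussianDensity_nonneg {E : Type*} [NormedAddCommGroup E] [InnerProductSpace ℝ E]
    (x : E) : 0 ≤ gaussianDensity x := by
  unfold gaussianDensity; positivity

lemma measurable_gaussianDensity {E : Type*} [NormedAddCommGroup E] [InnerProductSpace ℝ E]
    [MeasurableSpace E] [BorelSpace E] : Measurable (gaussianDensity : E → ℝ) := by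
  unfold gaussianDensity; fun_prop

variable {E : Type*} [NormedAddCommGroup E] [InnerProductSpace ℝ E] [FiniteDimensional ℝ E]
  [MeasurableSpace E] [BorelSpace E]

lemma integral_gaussianDensity : ∫ x : E, gaussianDensity x = 1 := by
  unfold gaussianDensity
  rw [integral_const_mul, GaussianFourier.integral_rexp_neg_mul_sq_norm (by norm_num)]
  rw [show Real.pi / (1 / 2) = 2 * Real.pi by ring]
  exact inv_mul_cancel₀ (by positivity)

lemma integrable_gaussianDensity : Integrable (gaussianDensity : E → ℝ) := by
  by_contra h
  have := integral_gaussianDensity (E := E)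
  rw [integral_undef h] at this
  norm_num at this

lemma isProbabilityMeasure_gaussianDensity :
    IsProbabilityMeasure
      ((volume : Measure E).withDensity fun x => ENNReal.ofReal (gaussianDensity x)) := by
  constructor
  rw [withDensity_apply _ MeasurableSet.univ, Measure.restrict_univ,
    ← ofReal_integral_eq_lintegral_ofReal integrable_gaussianDensity
      (ae_of_all _ gaussianDensity_nonneg), integral_gaussianDensity, ENNReal.ofReal_one]

/-- Both sides are finite measures with the same characteristic function. The density is what makes
the change of variables under translation explicit. -/
lemma stdGaussian_eq_withDensity :
    stdGaussian E = (volume : Measure E).withDensity fun x => ENNReal.ofReal (gaussianDensity x) := by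
  have := isProbabilityMeasure_gaussianDensity (E := E)
  apply Measure.ext_of_charFun
  ext t
  rw [charFun_stdGaussian, charFun_apply,
    integral_withDensity_eq_integral_toReal_smul
      (measurable_gaussianDensity.ennreal_ofReal) (ae_of_all _ fun _ => ENNReal.ofReal_lt_top)]
  have h1 : ∀ x : E, (ENNReal.ofReal (gaussianDensity x)).toReal •
      Complex.exp ((⟪x, t⟫ : ℝ) * Complex.I) =
      (((2 * Real.pi) ^ (Module.finrank ℝ E / 2 : ℝ) : ℝ) : ℂ)⁻¹ *
        Complex.exp (-(1 / 2 : ℂ) * ‖x‖ ^ 2 + Complex.I * (⟪t, x⟫ : ℝ)) := by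
    intro x
    rw [ENNReal.toReal_ofReal (gaussianDensity_nonneg x), gaussianDensity, Complex.exp_add,
      real_inner_comm, Complex.real_smul]
    push_cast
    ring_nf
  simp_rw [h1]
  rw [integral_const_mul, GaussianFourier.integral_cexp_neg_mul_sq_norm_add (by norm_num)]
  have h2 : ((((2 * Real.pi) ^ (Module.finrank ℝ E / 2 : ℝ) : ℝ) : ℂ)) =
      ((Real.pi : ℂ) / (1 / 2)) ^ (Module.finrank ℝ E / 2 : ℂ) := by
    rw [Complex.ofReal_cpow (by positivity)]
    push_cast
    congr 1
    ring
  rw [← h2, ← mul_assoc, inv_mul_cancel₀, one_mul]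
  · congr 1
    rw [Complex.I_sq]
    ring
  · rw [Complex.ofReal_ne_zero]
    positivity

/-- Change of variables for a translated Gaussian. -/
lemma lintegral_stdGaussian_shift (u : E) {F : E → ENNReal} (hF : Measurable F) :
    ∫⁻ x, F x ∂stdGaussian E =
      ∫⁻ x, F (u + x) * ENNReal.ofReal (Real.exp (-⟪u, x⟫ - ‖u‖ ^ 2 / 2)) ∂stdGaussian E := by
  have hm := (measurable_gaussianDensity (E := E)).ennreal_ofReal
  rw [stdGaussian_eq_withDensity, lintegral_withDensity_eq_lintegral_mul _ hm hF,
    lintegral_withDensity_eq_lintegral_mul _ hm (by fun_prop),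
    ← lintegral_add_left_eq_self _ u]
  refine lintegral_congr fun x => ?_
  simp only [Pi.mul_apply]
  rw [mul_comm (F _), ← mul_assoc, ← ENNReal.ofReal_mul (gaussianDensity_nonneg x), mul_comm,
    mul_comm (F _)]
  congr 2
  unfold gaussianDensity
  rw [mul_assoc, ← Real.exp_add, norm_add_sq_real]
  ring_nf

/-- No sign is assumed: the negative part only lowers the left side. This is needed for tangent
lines, which may be negative. -/
lemma ofReal_integral_le_lintegral {α : Type*} {m : MeasurableSpace α} {μ : Measure α}
    {f : α → ℝ} (hf : Integrable f μ) :
    ENNReal.ofReal (∫ x, f x ∂μ) ≤ ∫⁻ x, ENNReal.ofReal (f x) ∂μ := by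
  rw [integral_eq_lintegral_pos_part_sub_lintegral_neg_part hf]
  refine (ENNReal.ofReal_le_ofReal (sub_le_self _ ENNReal.toReal_nonneg)).trans ?_
  exact ENNReal.ofReal_toReal_le

/-- Jensen's inequality for the exponential function. -/
lemma ofReal_exp_integral_le {α : Type*} {m : MeasurableSpace α} {μ : Measure α}
    [IsProbabilityMeasure μ] {g : α → ℝ} (hg : Integrable g μ) :
    ENNReal.ofReal (Real.exp (∫ x, g x ∂μ)) ≤ ∫⁻ x, ENNReal.ofReal (Real.exp (g x)) ∂μ := by
  set c := ∫ x, g x ∂μ with hc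
  -- The tangent line of exp at the mean c, evaluated at g x; it lies below exp and integrates to
  -- exp c. Integrability of exp ∘ g is not required.
  have hint : Integrable (fun x => Real.exp c * (1 + (g x - c))) μ := by fun_prop
  have h1 : ∫ x, Real.exp c * (1 + (g x - c)) ∂μ = Real.exp c := by
    rw [integral_const_mul, integral_add (by fun_prop) (by fun_prop),
      integral_sub hg (by fun_prop)]
    simp [← hc]
  calc ENNReal.ofReal (Real.exp c) = ENNReal.ofReal (∫ x, Real.exp c * (1 + (g x - c)) ∂μ) := by
        rw [h1]
    _ ≤ _ := ofReal_integral_le_lintegral hint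
    _ ≤ _ := by
      refine lintegral_mono fun x => ENNReal.ofReal_le_ofReal ?_
      have : Real.exp (g x) = Real.exp c * Real.exp (g x - c) := by
        rw [← Real.exp_add]; congr 1; ring
      rw [this]
      gcongr
      linarith [Real.add_one_le_exp (g x - c)]

lemma integrable_inner_stdGaussian (u : E) : Integrable (fun x : E => ⟪u, x⟫) (stdGaussian E) :=
  IsGaussian.integrable_dual (stdGaussian E) (innerSL ℝ u)

lemma integral_inner_stdGaussian (u : E) : ∫ x : E, ⟪u, x⟫ ∂stdGaussian E = 0 :=
  integral_strongDual_stdGaussian (innerSL ℝ u)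

/-- The Gibbs variational inequality between a Gaussian and its translates. -/
lemma ofReal_exp_integral_shift_le (u : E) {h : E → ℝ} (hm : Measurable h)
    (hi : Integrable (fun x => h (u + x)) (stdGaussian E)) :
    ENNReal.ofReal (Real.exp (∫ x, h (u + x) ∂stdGaussian E - ‖u‖ ^ 2 / 2)) ≤
      ∫⁻ x, ENNReal.ofReal (Real.exp (h x)) ∂stdGaussian E := by
  have hu := integrable_inner_stdGaussian u
  have key : ∫ x, (h (u + x) - ⟪u, x⟫ - ‖u‖ ^ 2 / 2) ∂stdGaussian E =
      ∫ x, h (u + x) ∂stdGaussian E - ‖u‖ ^ 2 / 2 := by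
    have hs : Integrable (fun x => h (u + x) - ⟪u, x⟫) (stdGaussian E) := hi.sub hu
    rw [integral_sub hs (by fun_prop), integral_sub hi hu, integral_inner_stdGaussian]
    simp
  -- After recentering, the exponent gains the log-density -⟪u, x⟫ - ‖u‖²/2. Its linear part has
  -- mean zero, so Jensen loses exactly the relative entropy ‖u‖²/2.
  rw [← key, lintegral_stdGaussian_shift u (by fun_prop)]
  refine (ofReal_exp_integral_le ((hi.sub hu).sub (by fun_prop))).trans (le_of_eq ?_)
  refine lintegral_congr fun x => ?_
  rw [← ENNReal.ofReal_mul (by positivity), ← Real.exp_add]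
  simp only [Pi.sub_apply]
  congr 2
  ring

lemma stdGaussian_map_neg : (stdGaussian E).map (fun x => -x) = stdGaussian E := by
  simpa using stdGaussian_map (E := E) (LinearIsometryEquiv.neg ℝ)

/-- By symmetry the two closed half-spaces have equal mass, and together they cover the space. -/
lemma half_le_stdGaussian_inner_nonneg (z : E) :
    1 / 2 ≤ (stdGaussian E).real {x | 0 ≤ ⟪x, z⟫} := by
  have h1 : (stdGaussian E).real {x | 0 ≤ ⟪x, z⟫} = (stdGaussian E).real {x | ⟪x, z⟫ ≤ 0} := by
    conv_lhs => rw [← stdGaussian_map_neg]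
    rw [map_measureReal_apply (by fun_prop)
      (measurableSet_le (by fun_prop) (by fun_prop))]
    simp
  have h2 : (1 : ℝ) ≤ (stdGaussian E).real {x | 0 ≤ ⟪x, z⟫}
      + (stdGaussian E).real {x | ⟪x, z⟫ ≤ 0} := by
    refine le_trans (le_of_eq ?_) (measureReal_union_le _ _)
    rw [show {x : E | 0 ≤ ⟪x, z⟫} ∪ {x | ⟪x, z⟫ ≤ 0} = Set.univ by
      ext x; simp [le_total]]
    simp
  linarith

/-- A Gaussian perturbation of `u` keeps `|⟪u, z⟫|` large with probability at least `1 / 2`. -/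
lemma half_le_stdGaussian_lt_abs_inner {u z : E} {q : ℝ} (h : q < |⟪u, z⟫|) :
    1 / 2 ≤ (stdGaussian E).real {x | q < |⟪u + x, z⟫|} := by
  rcases le_total 0 ⟪u, z⟫ with h0 | h0
  · refine (half_le_stdGaussian_inner_nonneg z).trans (measureReal_mono fun x hx => ?_)
    simp only [Set.mem_ofPred_eq] at hx ⊢
    rw [abs_of_nonneg h0] at h
    rw [inner_add_left]
    exact h.trans_le ((le_add_of_nonneg_right hx).trans (le_abs_self _))
  · refine (half_le_stdGaussian_inner_nonneg (-z)).trans (measureReal_mono fun x hx => ?_)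
    simp only [Set.mem_ofPred_eq, inner_neg_right] at hx ⊢
    rw [abs_of_nonpos h0] at h
    rw [inner_add_left]
    exact h.trans_le (by linarith [neg_abs_le (⟪u, z⟫ + ⟪x, z⟫)])

end Gaussian

/-! ### PAC-Bayes bound for counts of large projections. -/

section PACBayes

open scoped RealInnerProductSpace Finset

variable {E : Type*} [NormedAddCommGroup E] [InnerProductSpace ℝ E] [FiniteDimensional ℝ E]
  [MeasurableSpace E] [BorelSpace E]
  {Ω : Type*} [MeasurableSpace Ω] {Pr : Measure Ω} [IsProbabilityMeasure Pr]
  {ι : Type*} [Fintype ι]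

/-- The exponential moment of the number of independent events that occur. -/
lemma integral_exp_sum_indicator_le {A : ι → Ω → ℝ}
    (hA : ∀ i, Measurable (A i)) (h01 : ∀ i ω, A i ω = 0 ∨ A i ω = 1) (hind : iIndepFun A Pr)
    {p : ℝ} (hp : ∀ i, ∫ ω, A i ω ∂Pr ≤ p) :
    ∫ ω, Real.exp (∑ i, A i ω) ∂Pr ≤ Real.exp (2 * Fintype.card ι * p) := by
  have hi : ∀ i, Integrable (A i) Pr := fun i =>
    Integrable.of_bound (hA i).aestronglyMeasurable 1
      (ae_of_all _ fun ω => by rcases h01 i ω with h | h <;> simp [h])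
  -- exp is affine on {0, 1}; with e - 1 ≤ 2 each factor is at most 1 + 2p ≤ exp (2p).
  have hexp : ∀ i ω, Real.exp (A i ω) = 1 + (Real.exp 1 - 1) * A i ω := by
    intro i ω; rcases h01 i ω with h | h <;> simp [h]
  have hmgf : ∀ i, mgf (A i) Pr 1 ≤ Real.exp (2 * p) := by
    intro i
    simp only [mgf, one_mul, hexp]
    rw [integral_add (by fun_prop) ((hi i).const_mul _), integral_const_mul]
    have h0 : 0 ≤ ∫ ω, A i ω ∂Pr :=
      integral_nonneg fun ω => by rcases h01 i ω with h | h <;> simp [h]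
    have he : Real.exp 1 - 1 ≤ 2 := by linarith [Real.exp_one_lt_d9]
    have := Real.add_one_le_exp (2 * p)
    simp only [integral_const, probReal_univ, smul_eq_mul, mul_one]
    nlinarith [hp i]
  have h := hind.mgf_sum (t := 1) hA Finset.univ
  simp only [mgf, one_mul, Finset.sum_apply] at h
  rw [h]
  calc ∏ i, ∫ ω, Real.exp (A i ω) ∂Pr ≤ ∏ _i : ι, Real.exp (2 * p) := by
        refine Finset.prod_le_prod (fun i _ => integral_nonneg fun ω => (Real.exp_pos _).le)
          fun i _ => ?_
        simpa [mgf] using hmgf i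
    _ = _ := by
      rw [Finset.prod_const, ← Real.exp_nat_mul, Finset.card_univ]
      congr 1; ring

open Classical in
/-- A uniform bound, over all directions, for the number of large projections of independent
random vectors. -/
lemma measure_exists_card_large_inner_gt_le {Z : ι → Ω → E} (hZ : ∀ i, Measurable (Z i))
    (hind : iIndepFun Z Pr) {q : ℝ} {Q : E → ℝ} (hQm : Measurable Q)
    (hQ : ∀ θ i, Pr.real {ω | q < |⟪θ, Z i ω⟫|} ≤ Q θ)
    (hQi : ∀ u, Integrable (fun x => Q (u + x)) (stdGaussian E)) (t : ℝ) :
    Pr {ω | ¬ ∀ u : E, (#{i | q < |⟪u, Z i ω⟫|} : ℝ) ≤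
      2 * (t + ‖u‖ ^ 2 / 2 + 2 * Fintype.card ι * ∫ x, Q (u + x) ∂stdGaussian E)} ≤
      ENNReal.ofReal (Real.exp (-t)) := by
  set A : E → ι → Ω → ℝ := fun θ i ω => if q < |⟪θ, Z i ω⟫| then 1 else 0 with hAdef
  have hset : MeasurableSet {x : E × E | q < |⟪x.1, x.2⟫|} :=
    measurableSet_lt measurable_const (by fun_prop)
  have hF : Measurable fun x : E × E => if q < |⟪x.1, x.2⟫| then (1 : ℝ) else 0 :=
    Measurable.ite hset measurable_const measurable_const
  have hA2 : ∀ i, Measurable fun x : Ω × E => A x.2 i x.1 := fun i =>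
    hF.comp (measurable_snd.prodMk ((hZ i).comp measurable_fst))
  have hAθ : ∀ θ i, Measurable (A θ i) := fun θ i =>
    hF.comp (measurable_const.prodMk (hZ i))
  have h01 : ∀ θ i ω, A θ i ω = 0 ∨ A θ i ω = 1 := by
    intro θ i ω; simp only [hAdef]; split_ifs <;> simp
  -- The count, compensated so that exp (h · θ) has expectation at most 1 for each fixed θ.
  set h : Ω → E → ℝ := fun ω θ => ∑ i, A θ i ω - 2 * Fintype.card ι * Q θ with hh
  have hhm : Measurable fun x : Ω × E => h x.1 x.2 := by
    refine Measurable.sub (Finset.measurable_sum _ fun i _ => hA2 i) ?_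
    exact (hQm.comp measurable_snd).const_mul _
  -- W does not depend on u, so the single event W ≥ exp t given by Markov covers the failures in
  -- all directions at once.
  set W : Ω → ENNReal := fun ω => ∫⁻ θ, ENNReal.ofReal (Real.exp (h ω θ)) ∂stdGaussian E with hW
  have hWm : Measurable W := Measurable.lintegral_prod_right' (f := fun x : Ω × E =>
    ENNReal.ofReal (Real.exp (h x.1 x.2))) (by fun_prop)
  have hEW : ∫⁻ ω, W ω ∂Pr ≤ 1 := by
    rw [hW, lintegral_lintegral_swap (by unfold Function.uncurry; fun_prop)]
    calc _ ≤ ∫⁻ _θ : E, 1 ∂stdGaussian E := by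
          refine lintegral_mono fun θ => ?_
          have hAi : ∀ i, ∫ ω, A θ i ω ∂Pr ≤ Q θ := by
            intro i
            refine le_trans (le_of_eq ?_) (hQ θ i)
            have : A θ i = Set.indicator {ω | q < |⟪θ, Z i ω⟫|} 1 := by
              ext ω; simp [hAdef, Set.indicator_apply]
            rw [this, integral_indicator_one]
            exact measurableSet_lt measurable_const ((hZ i).const_inner.abs)
          have hb := integral_exp_sum_indicator_le (Pr := Pr) (hAθ θ) (h01 θ)
            (hind.comp (fun _ z => if q < |⟪θ, z⟫| then (1 : ℝ) else 0)
              fun _ => hF.comp (measurable_const.prodMk measurable_id)) hAi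
          have hint : Integrable (fun ω => Real.exp (h ω θ)) Pr := by
            refine Integrable.of_bound
              (by have := hhm.comp (measurable_prodMk_right (y := θ)); fun_prop)
              (Real.exp (Fintype.card ι - 2 * Fintype.card ι * Q θ)) (ae_of_all _ fun ω => ?_)
            rw [Real.norm_eq_abs, Real.abs_exp, Real.exp_le_exp]
            refine sub_le_sub_right ?_ _
            refine (Finset.sum_le_card_nsmul _ _ 1 fun i _ => ?_).trans (by simp)
            rcases h01 θ i ω with h | h <;> simp [h]
          rw [← ofReal_integral_eq_lintegral_ofReal hint (ae_of_all _ fun _ => (Real.exp_pos _).le),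
            ← ENNReal.ofReal_one]
          refine ENNReal.ofReal_le_ofReal ?_
          simp only [hh, sub_eq_add_neg, Real.exp_add]
          rw [integral_mul_const, Real.exp_neg]
          exact mul_inv_le_one_of_le₀ hb (Real.exp_pos _).le
      _ = 1 := by simp
  have hmarkov : Pr {ω | ENNReal.ofReal (Real.exp t) ≤ W ω} ≤ ENNReal.ofReal (Real.exp (-t)) := by
    have h1 := (mul_meas_ge_le_lintegral (μ := Pr) hWm (ENNReal.ofReal (Real.exp t))).trans hEW
    rw [Real.exp_neg, ENNReal.ofReal_inv_of_pos (Real.exp_pos t)]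
    rw [mul_comm] at h1
    exact ENNReal.le_inv_iff_mul_le.2 h1
  refine (measure_mono fun ω hω => ?_).trans hmarkov
  simp only [Set.mem_ofPred_eq, not_forall, not_le] at hω ⊢
  obtain ⟨u, hu⟩ := hω
  have hAi : ∀ i, Integrable (fun x => A (u + x) i ω) (stdGaussian E) := fun i =>
    Integrable.of_bound (by
        have := (hA2 i).comp (measurable_prodMk_left (x := ω))
        exact (this.comp (measurable_const_add u)).aestronglyMeasurable) 1
      (ae_of_all _ fun x => by rcases h01 (u + x) i ω with h | h <;> simp [h])
  have hi1 : Integrable (fun x => ∑ i, A (u + x) i ω) (stdGaussian E) :=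
    integrable_finsetSum _ fun i _ => hAi i
  have hi : Integrable (fun x => h ω (u + x)) (stdGaussian E) := hi1.sub ((hQi u).const_mul _)
  have hJ := ofReal_exp_integral_shift_le u (h := h ω)
    (hhm.comp (measurable_prodMk_left (x := ω))) hi
  refine le_trans (ENNReal.ofReal_le_ofReal (Real.exp_le_exp.2 ?_)) hJ
  simp only [hh]
  rw [integral_sub hi1 ((hQi u).const_mul _), integral_const_mul,
    integral_finsetSum _ fun i _ => hAi i]
  -- A projection that is large at u stays large at u + x with probability at least 1/2, whence the
  -- factor 2.
  have hcount : (#{i | q < |⟪u, Z i ω⟫|} : ℝ) ≤ 2 * ∑ i, ∫ x, A (u + x) i ω ∂stdGaussian E := by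
    rw [Finset.card_filter]
    push_cast
    rw [Finset.mul_sum]
    refine Finset.sum_le_sum fun i _ => ?_
    have hint : ∫ x, A (u + x) i ω ∂stdGaussian E =
        (stdGaussian E).real {x | q < |⟪u + x, Z i ω⟫|} := by
      have : (fun x => A (u + x) i ω) = Set.indicator {x | q < |⟪u + x, Z i ω⟫|} 1 := by
        ext ω; simp [hAdef, Set.indicator_apply]
      rw [this, integral_indicator_one]
      exact measurableSet_lt measurable_const (by fun_prop)
    rw [hint]
    split_ifs with hq
    · linarith [half_le_stdGaussian_lt_abs_inner hq]
    · positivity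
  linarith

end PACBayes

/-! ### From directions to quadratic forms, by random signs. -/

section Rounding

open scoped RealInnerProductSpace Finset

variable {E : Type*} [NormedAddCommGroup E] [InnerProductSpace ℝ E] {ι : Type*}

/-- The total squared length of a list of vectors in the direction `z`. -/
def listQuad (l : List E) (z : E) : ℝ := (l.map fun x => ⟪x, z⟫ ^ 2).sum

/-- The sum of the squared norms of a list of vectors. -/
def listNormSq (l : List E) : ℝ := (l.map fun x => ‖x‖ ^ 2).sum

/-- Choosing signs one after the other: some signed sum of the vectors in `l`, started at `c`, does
at least as well as the average over all signs. -/
lemma exists_signed_sum_ge_average (s : Finset ι) (z : ι → E) (α β : ι → ℝ) (hβ : ∀ i, 0 ≤ β i)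
    (B : ℝ) (l : List E) : ∀ c : E, ∃ y : E,
      ∑ i ∈ s, (α i * (⟪c, z i⟫ ^ 2 + listQuad l (z i)) - β i * (⟪c, z i⟫ ^ 4 +
        6 * ⟪c, z i⟫ ^ 2 * listQuad l (z i) + 3 * listQuad l (z i) ^ 2)) -
        B * (‖c‖ ^ 2 + listNormSq l) ≤
      ∑ i ∈ s, (α i * ⟪y, z i⟫ ^ 2 - β i * ⟪y, z i⟫ ^ 4) - B * ‖y‖ ^ 2 := by
  -- For a random signed sum y started at c, the mean of ⟪y, z⟫² is ⟪c, z⟫² plus `listQuad l z`, and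
  -- the quartic expression is the Gaussian upper bound for the mean of ⟪y, z⟫⁴.
  induction l with
  | nil => intro c; exact ⟨c, by simp [listQuad, listNormSq]⟩
  | cons x l ih =>
    intro c
    obtain ⟨y₁, h₁⟩ := ih (c + x)
    obtain ⟨y₂, h₂⟩ := ih (c - x)
    have hn : ‖c + x‖ ^ 2 + ‖c - x‖ ^ 2 = 2 * (‖c‖ ^ 2 + ‖x‖ ^ 2) := by
      rw [norm_add_sq_real, norm_sub_sq_real]; ring
    have hl : listNormSq (x :: l) = ‖x‖ ^ 2 + listNormSq l := by simp [listNormSq]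
    have hq : ∀ w, listQuad (x :: l) w = ⟪x, w⟫ ^ 2 + listQuad l w := by simp [listQuad]
    have hsum : 2 * ∑ i ∈ s, (α i * (⟪c, z i⟫ ^ 2 + listQuad (x :: l) (z i)) -
          β i * (⟪c, z i⟫ ^ 4 + 6 * ⟪c, z i⟫ ^ 2 * listQuad (x :: l) (z i) +
            3 * listQuad (x :: l) (z i) ^ 2)) ≤
        ∑ i ∈ s, (α i * (⟪c + x, z i⟫ ^ 2 + listQuad l (z i)) - β i * (⟪c + x, z i⟫ ^ 4 +
          6 * ⟪c + x, z i⟫ ^ 2 * listQuad l (z i) + 3 * listQuad l (z i) ^ 2)) +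
        ∑ i ∈ s, (α i * (⟪c - x, z i⟫ ^ 2 + listQuad l (z i)) - β i * (⟪c - x, z i⟫ ^ 4 +
          6 * ⟪c - x, z i⟫ ^ 2 * listQuad l (z i) + 3 * listQuad l (z i) ^ 2)) := by
      rw [Finset.mul_sum, ← Finset.sum_add_distrib]
      refine Finset.sum_le_sum fun i _ => ?_
      rw [hq, inner_add_left, inner_sub_left]
      -- The excess of the Gaussian fourth moment over that of a sign, summed over both choices.
      have := mul_nonneg (hβ i) (by positivity : 0 ≤ 4 * ⟪x, z i⟫ ^ 4)
      linear_combination this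
    have hB : B * (‖c + x‖ ^ 2 + listNormSq l) + B * (‖c - x‖ ^ 2 + listNormSq l) =
        2 * (B * (‖c‖ ^ 2 + listNormSq (x :: l))) := by
      rw [hl]; linear_combination B * hn
    rcases le_total
      (∑ i ∈ s, (α i * ⟪y₁, z i⟫ ^ 2 - β i * ⟪y₁, z i⟫ ^ 4) - B * ‖y₁‖ ^ 2)
      (∑ i ∈ s, (α i * ⟪y₂, z i⟫ ^ 2 - β i * ⟪y₂, z i⟫ ^ 4) - B * ‖y₂‖ ^ 2) with h | h
    · exact ⟨y₂, by linarith⟩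
    · exact ⟨y₁, by linarith⟩

open Classical in
/-- A bound for the number of large projections in every direction gives one for the number of large
values of every quadratic form of trace at most one. -/
lemma card_large_listQuad_le [Fintype ι] (z : ι → E) {q A B : ℝ} (hB : 0 ≤ B)
    (h : ∀ y : E, (#{i | q < |⟪y, z i⟫|} : ℝ) ≤ A + B * ‖y‖ ^ 2)
    (l : List E) (hl : listNormSq l ≤ 1) :
    (#{i | 2 * q ^ 2 < listQuad l (z i)} : ℝ) ≤ 12 * (A + B) := by
  set J : Finset ι := {i | 2 * q ^ 2 < listQuad l (z i)} with hJ
  have hpos : ∀ i ∈ J, 2 * q ^ 2 < listQuad l (z i) := fun i hi => by simpa [hJ] using hi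
  -- With r = ⟪y, z i⟫² / s and s = `listQuad l (z i)`, the summand is r/3 - r²/36. It averages to
  -- at least 1/3 - 3/36 = 1/4, never exceeds 1 (at r = 6), and is at most 1/6 when r ≤ 1/2, which
  -- holds if |⟪y, z i⟫| ≤ q because s > 2q².
  obtain ⟨y, hy⟩ := exists_signed_sum_ge_average J z (fun i => (3 * listQuad l (z i))⁻¹)
    (fun i => (36 * listQuad l (z i) ^ 2)⁻¹) (fun i => by positivity) B l 0
  have h1 : ∑ i ∈ J, ((3 * listQuad l (z i))⁻¹ * (⟪(0 : E), z i⟫ ^ 2 + listQuad l (z i)) -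
      (36 * listQuad l (z i) ^ 2)⁻¹ * (⟪(0 : E), z i⟫ ^ 4 +
        6 * ⟪(0 : E), z i⟫ ^ 2 * listQuad l (z i) + 3 * listQuad l (z i) ^ 2)) =
      ∑ i ∈ J, (1 / 4 : ℝ) := by
    refine Finset.sum_congr rfl fun i hi => ?_
    have : 0 < listQuad l (z i) := lt_of_le_of_lt (by positivity) (hpos i hi)
    simp only [inner_zero_left]
    field_simp
    norm_num
    ring
  have h2 : ∑ i ∈ J, ((3 * listQuad l (z i))⁻¹ * ⟪y, z i⟫ ^ 2 -
      (36 * listQuad l (z i) ^ 2)⁻¹ * ⟪y, z i⟫ ^ 4) ≤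
      ∑ i ∈ J, ((1 / 6 : ℝ) + if q < |⟪y, z i⟫| then 1 else 0) := by
    refine Finset.sum_le_sum fun i hi => ?_
    have hs : 0 < listQuad l (z i) := lt_of_le_of_lt (by positivity) (hpos i hi)
    set s := listQuad l (z i)
    set r := ⟪y, z i⟫ ^ 2 / s with hr
    have hr0 : 0 ≤ r := by positivity
    have e1 : (3 * s)⁻¹ * ⟪y, z i⟫ ^ 2 = r / 3 := by rw [hr]; field_simp
    have e2 : (36 * s ^ 2)⁻¹ * ⟪y, z i⟫ ^ 4 = r ^ 2 / 36 := by rw [hr]; field_simp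
    rw [e1, e2]
    split_ifs with hlt
    · nlinarith [sq_nonneg (r - 6)]
    · have h3 : ⟪y, z i⟫ ^ 2 ≤ q ^ 2 := by
        rw [← sq_abs]; exact pow_le_pow_left₀ (abs_nonneg _) (not_lt.1 hlt) 2
      have h4 : r ≤ 1 / 2 := by
        rw [hr, div_le_iff₀ hs]; linarith [hpos i hi]
      nlinarith [sq_nonneg r]
  have h3 : ∑ i ∈ J, (if q < |⟪y, z i⟫| then (1 : ℝ) else 0) ≤ #{i | q < |⟪y, z i⟫|} := by
    rw [Finset.card_filter]
    push_cast
    exact Finset.sum_le_univ_sum_of_nonneg fun i => by split_ifs <;> norm_num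
  rw [h1] at hy
  rw [Finset.sum_add_distrib] at h2
  simp only [Finset.sum_const, nsmul_eq_mul, norm_zero] at hy h2
  -- The penalty B‖y‖² cancels the uncontrolled term of the count at y. What remains is #J/4 - B ≤
  -- #J/6 + A.
  have := h y
  nlinarith [mul_le_mul_of_nonneg_left hl hB]

/-- The vectors of values at `z` of the quadratic forms of trace at most one. -/
def quadValues (z : ι → E) : Set (ι → ℝ) :=
  {a | ∃ l : List E, listNormSq l ≤ 1 ∧ a = fun i => listQuad l (z i)}

/-- Concatenating lists adds the forms, and scaling the vectors by √a scales a form by a. Single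
directions would not give a convex set, which is why lists are used. -/
lemma convex_quadValues (z : ι → E) : Convex ℝ (quadValues z) := by
  rintro _ ⟨l₁, h₁, rfl⟩ _ ⟨l₂, h₂, rfl⟩ a b ha hb hab
  have hN : ∀ (c : ℝ) (hc : 0 ≤ c) (l : List E),
      listNormSq (l.map fun x => √c • x) = c * listNormSq l := by
    intro c hc l
    simp [listNormSq, Function.comp_def, norm_smul, mul_pow, List.sum_map_mul_left,
      Real.sq_sqrt hc]
  have hQ : ∀ (c : ℝ) (hc : 0 ≤ c) (l : List E) (w : E),
      listQuad (l.map fun x => √c • x) w = c * listQuad l w := by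
    intro c hc l w
    simp [listQuad, Function.comp_def, real_inner_smul_left, mul_pow, List.sum_map_mul_left,
      Real.sq_sqrt hc]
  refine ⟨l₁.map (fun x => √a • x) ++ l₂.map (fun x => √b • x), ?_, ?_⟩
  · have : listNormSq (l₁.map (fun x => √a • x) ++ l₂.map (fun x => √b • x)) =
        a * listNormSq l₁ + b * listNormSq l₂ := by
      rw [← hN a ha, ← hN b hb]; simp [listNormSq]
    rw [this]; nlinarith
  · ext i
    have : listQuad (l₁.map (fun x => √a • x) ++ l₂.map (fun x => √b • x)) (z i) =
        a * listQuad l₁ (z i) + b * listQuad l₂ (z i) := by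
      rw [← hQ a ha, ← hQ b hb]; simp [listQuad]
    simp [this]

end Rounding

/-! ### One system of weights for all forms, by Sion's minimax theorem. -/

section Minimax

open scoped Finset

variable {ι : Type*} [Fintype ι]

open Classical in
/-- If every vector in a convex set of nonnegative vectors has few large entries, then one set of
weights works for all of them. -/
lemma exists_weights {Y : Set (ι → ℝ)} (hY : Convex ℝ Y)
    {M N : ℝ} (hM : 0 ≤ M) (hN : 0 ≤ N) (hcard : ∀ a ∈ Y, (#{i | M < a i} : ℝ) ≤ N) :
    ∃ w : ι → ℝ, (∀ i, 0 ≤ w i ∧ w i ≤ 1) ∧ Fintype.card ι - N ≤ ∑ i, w i ∧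
      ∀ a ∈ Y, ∑ i, w i * a i ≤ M * Fintype.card ι := by
  by_contra! hcon
  set X : Set (ι → ℝ) := Set.Icc 0 1 ∩ {w | Fintype.card ι - N ≤ ∑ i, w i} with hX
  have kX : IsCompact X := isCompact_Icc.inter_right
    (isClosed_le continuous_const (by fun_prop))
  have cX : Convex ℝ X := by
    refine (convex_Icc 0 1).inter ?_
    exact convex_halfSpace_ge (f := fun w : ι → ℝ => ∑ i, w i)
      ⟨fun x y => by simp [Finset.sum_add_distrib], fun c x => by simp [Finset.mul_sum]⟩ _
  have neX : X.Nonempty := ⟨1, ⟨by simp, le_rfl⟩, by simp [hN]⟩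
  set f : (ι → ℝ) → (ι → ℝ) → ℝ := fun w a => ∑ i, w i * a i with hf
  have hcov : ∀ x ∈ X, ∃ a ∈ Y, M * Fintype.card ι < f x a := fun x hx =>
    hcon x (fun i => ⟨hx.1.1 i, hx.1.2 i⟩) hx.2
  -- Y need not be compact; compactness of X reduces the choice of a to finitely many candidates.
  obtain ⟨s, hsY, hs, hcov'⟩ : ∃ s ⊆ Y, s.Finite ∧ ∀ x ∈ X, ∃ a ∈ s, M * Fintype.card ι < f x a := by
    obtain ⟨s, hsY, hs, hsub⟩ := kX.elim_finite_subcover_image (b := Y)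
      (c := fun a => {x | M * Fintype.card ι < f x a})
      (fun a _ => isOpen_lt continuous_const (by fun_prop))
      (fun x hx => by simpa using hcov x hx)
    exact ⟨s, hsY, hs, fun x hx => by simpa using hsub hx⟩
  have lin1 : ∀ a, IsLinearMap ℝ fun x => f x a := fun a =>
    ⟨fun x y => by simp [hf, add_mul, Finset.sum_add_distrib],
      fun c x => by simp [hf, Finset.mul_sum, mul_assoc]⟩
  have lin2 : ∀ x, IsLinearMap ℝ fun a => f x a := fun x =>
    ⟨fun a b => by simp [hf, mul_add, Finset.sum_add_distrib],
      fun c a => by simp [hf, Finset.mul_sum, mul_left_comm]⟩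
  obtain ⟨a, haY, ha⟩ := Sion.exists_lt_iInf_of_lt_iInf_of_finite (X := X) (Y := Y) (f := f) neX kX
    (fun a _ => (by fun_prop : Continuous fun x => f x a).continuousOn.lowerSemicontinuousOn)
    (fun a _ => (((lin1 a).mk' _).convexOn cX).quasiconvexOn) hY
    (fun x _ => (by fun_prop : Continuous fun a => f x a).continuousOn.upperSemicontinuousOn)
    (fun x _ => (((lin2 x).mk' _).concaveOn hY).quasiconcaveOn) cX hs hsY hcov'
  -- Minimax yields one a that defeats all weights, but the weights that drop its large entries are
  -- admissible and are not defeated.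
  set w : ι → ℝ := fun i => if M < a i then 0 else 1 with hw
  have hwX : w ∈ X := by
    refine ⟨⟨fun i => ?_, fun i => ?_⟩, ?_⟩
    · simp only [hw]; split_ifs <;> simp
    · simp only [hw]; split_ifs <;> simp
    · have h1 : ∑ i, w i = Fintype.card ι - #{i | M < a i} := by
        have : ∀ i, w i = 1 - if M < a i then (1 : ℝ) else 0 := by
          intro i; simp only [hw]; split_ifs <;> simp
        simp_rw [this]
        rw [Finset.sum_sub_distrib, Finset.card_filter]
        simp
      simp only [Set.mem_ofPred_eq, h1]
      linarith [hcard a haY]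
  refine absurd (ha w hwX) (not_lt.2 ?_)
  calc f w a ≤ ∑ _i : ι, M := by
        refine Finset.sum_le_sum fun i _ => ?_
        simp only [hw]
        split_ifs with h
        · simpa using hM
        · simpa using h
    _ = _ := by simp [mul_comm]

end Minimax

/-! ### From weights to a subset. -/

section Selection

open scoped RealInnerProductSpace Finset

variable {E : Type*} [NormedAddCommGroup E] [InnerProductSpace ℝ E] {ι : Type*} [Fintype ι]

open Classical in
/-- Few large projections in every direction: after removal of few points, the second moments are
bounded in every direction. -/
lemma exists_finset_sum_inner_sq_le (z : ι → E) {q A B : ℝ} (hA : 0 ≤ A) (hB : 0 ≤ B)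
    (h : ∀ y : E, (#{i | q < |⟪y, z i⟫|} : ℝ) ≤ A + B * ‖y‖ ^ 2) :
    ∃ s : Finset ι, Fintype.card ι - 24 * (A + B) ≤ #s ∧
      ∀ y : E, ∑ i ∈ s, ⟪y, z i⟫ ^ 2 ≤ 4 * q ^ 2 * Fintype.card ι * ‖y‖ ^ 2 := by
  obtain ⟨w, hw01, hw, hwa⟩ := exists_weights (convex_quadValues z)
    (M := 2 * q ^ 2) (N := 12 * (A + B)) (by positivity) (by positivity)
    (by rintro _ ⟨l, hl, rfl⟩; exact card_large_listQuad_le z hB h l hl)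
  refine ⟨Finset.univ.filter fun i => 1 / 2 ≤ w i, ?_, fun y => ?_⟩
  -- Summing gives ∑ w ≤ (card ι + #s)/2, so the loss 12(A + B) in total weight becomes 24(A + B) in
  -- cardinality.
  · have h1 : ∀ i, w i ≤ (1 + if 1 / 2 ≤ w i then 1 else 0) / 2 := by
      intro i
      split_ifs with hi
      · linarith [(hw01 i).2]
      · linarith [not_le.1 hi]
    have h2 := Finset.sum_le_sum fun i (_ : i ∈ Finset.univ) => h1 i
    rw [← Finset.sum_div, Finset.sum_add_distrib] at h2
    rw [Finset.card_filter]
    push_cast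
    simp only [Finset.sum_const, Finset.card_univ, nsmul_eq_mul, mul_one] at h2
    linarith
  · rcases eq_or_ne y 0 with rfl | hy
    · simp
    have hy' : 0 < ‖y‖ := norm_pos_iff.2 hy
    have h1 := hwa (fun i => listQuad [‖y‖⁻¹ • y] (z i))
      ⟨_, by simp [listNormSq, norm_smul, hy'.ne'], rfl⟩
    simp only [listQuad, List.map_cons, List.map_nil, List.sum_cons, List.sum_nil, add_zero,
      real_inner_smul_left, mul_pow] at h1
    have h2 : ∑ i, w i * ⟪y, z i⟫ ^ 2 ≤ 2 * q ^ 2 * Fintype.card ι * ‖y‖ ^ 2 := by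
      rw [← div_le_iff₀ (by positivity), Finset.sum_div]
      refine le_trans (le_of_eq (Finset.sum_congr rfl fun i _ => ?_)) h1
      field_simp
    rw [Finset.sum_filter]
    calc ∑ i, (if 1 / 2 ≤ w i then ⟪y, z i⟫ ^ 2 else 0) ≤ ∑ i, 2 * (w i * ⟪y, z i⟫ ^ 2) := by
          refine Finset.sum_le_sum fun i _ => ?_
          split_ifs with hi
          · nlinarith [sq_nonneg ⟪y, z i⟫]
          · have := (hw01 i).1
            positivity
      _ = 2 * ∑ i, w i * ⟪y, z i⟫ ^ 2 := by rw [Finset.mul_sum]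
      _ ≤ _ := by linarith

end Selection

/-! ### Corruptions as positionwise changes, and their effect on buckets. -/

section Corruption

open scoped Finset

lemma exists_perm_of_toMultiset_eq {E : Type*} {n : ℕ} {x y : Fin n → E}
    (h : toMultiset x = toMultiset y) : ∃ σ : Equiv.Perm (Fin n), ∀ i, y (σ i) = x i := by
  classical
  have hc : ∀ c, Nonempty ({i // x i = c} ≃ {i // y i = c}) := by
    intro c
    refine Fintype.card_eq.1 ?_
    have := congrArg (Multiset.count c) h
    simp only [toMultiset, Multiset.count_map] at this
    rw [Fintype.card_subtype, Fintype.card_subtype]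
    simpa [Finset.card_def, eq_comm] using this
  exact ⟨Equiv.ofFiberEquiv fun c => (hc c).some, fun i => Equiv.ofFiberEquiv_map _ i⟩

lemma toMultiset_get {E : Type*} {n : ℕ} (l : List E) (hl : l.length = n) :
    toMultiset (fun i : Fin n => l.get (i.cast hl.symm)) = (l : Multiset E) := by
  subst hl
  simp [toMultiset, Fin.univ_val_map]

open Classical in
/-- A corrupted sample agrees, up to a reordering, with the sample at all but few positions. -/
lemma exists_perm_of_isCorruption {E : Type*} {n : ℕ} {x t : Fin n → E} {ε : ℝ}
    (h : IsCorruption ε (toMultiset x) (toMultiset t)) :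
    ∃ ρ : Equiv.Perm (Fin n), (#{i | t i ≠ x (ρ i)} : ℝ) ≤ ε * n := by
  obtain ⟨U, R, A, hS, hT, hAR, hR⟩ := h
  have hx : (toMultiset x).card = n := by simp [toMultiset]
  have ht : (toMultiset t).card = n := by simp [toMultiset]
  have hlx : (U.toList ++ R.toList).length = n := by simp [← hx, hS]
  have hlt : (U.toList ++ A.toList).length = n := by simp [← ht, hT]
  obtain ⟨σ, hσ⟩ := exists_perm_of_toMultiset_eq (y := x)
    (x := fun i : Fin n => (U.toList ++ R.toList).get (i.cast hlx.symm)) (by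
      rw [toMultiset_get _ hlx, hS, ← Multiset.coe_add, Multiset.coe_toList, Multiset.coe_toList])
  obtain ⟨σ', hσ'⟩ := exists_perm_of_toMultiset_eq (y := t)
    (x := fun i : Fin n => (U.toList ++ A.toList).get (i.cast hlt.symm)) (by
      rw [toMultiset_get _ hlt, hT, ← Multiset.coe_add, Multiset.coe_toList, Multiset.coe_toList])
  refine ⟨σ'.symm.trans σ, le_trans ?_ (hx ▸ hR)⟩
  -- Both samples are listed with the common part U first, so they can differ only after it.
  have hcard : #{i : Fin n | t i ≠ x ((σ'.symm.trans σ) i)} ≤ #{i : Fin n | U.card ≤ i} := by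
    refine Finset.card_le_card_of_injOn σ'.symm (fun i hi => ?_) (Equiv.injective _).injOn
    rw [Finset.mem_coe, Finset.mem_filter] at hi ⊢
    refine ⟨Finset.mem_univ _, ?_⟩
    by_contra hlt'
    refine hi.2 ?_
    rw [Equiv.trans_apply]
    have h1 := hσ' (σ'.symm i)
    rw [Equiv.apply_symm_apply] at h1
    rw [h1, hσ]
    simp only [List.get_eq_getElem, Fin.val_cast]
    rw [List.getElem_append_left (by simpa using hlt'),
      List.getElem_append_left (by simpa using hlt')]
  have hcount : #{i : Fin n | U.card ≤ i} = R.card := by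
    have h1 : U.card + R.card = n := by rw [← hx, hS, Multiset.card_add]
    have h2 : #{i : Fin n | (i : ℕ) < U.card} = U.card := by
      rw [Fin.card_filter_val_lt]; omega
    have h3 := Finset.card_filter_add_card_filter_not (s := (Finset.univ : Finset (Fin n)))
      (fun i => (i : ℕ) < U.card)
    simp only [not_lt, Finset.card_univ, Fintype.card_fin] at h3
    omega
  exact_mod_cast hcount ▸ hcard

open Classical in
lemma isCorruption_toMultiset {E : Type*} {k : ℕ} {f g : Fin k → E} {ε : ℝ}
    (h : (#{b | g b ≠ f b} : ℝ) ≤ ε * k) : IsCorruption ε (toMultiset f) (toMultiset g) := by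
  have hsplit : ∀ w : Fin k → E, toMultiset w =
      ((Finset.univ.filter fun b => g b = f b).val.map w) +
        ((Finset.univ.filter fun b => g b ≠ f b).val.map w) := by
    intro w
    rw [← Multiset.map_add, Finset.filter_val, Finset.filter_val, Multiset.filter_add_not]
    rfl
  refine ⟨_, _, (Finset.univ.filter fun b => g b ≠ f b).val.map g, hsplit f, ?_, by simp, ?_⟩
  · rw [hsplit g]
    congr 1
    exact Multiset.map_congr rfl fun b hb => by simpa using hb
  · simpa [toMultiset, Finset.card_def] using h

open Classical in
/-- Each modified entry affects at most one bucket. -/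
lemma card_bucketMean_ne_le {d n k : ℕ} (w w' : Fin n → Vec d) :
    #{b | bucketMean k w b ≠ bucketMean k w' b} ≤ #{i | w i ≠ w' i} := by
  have hex : ∀ b, bucketMean k w b ≠ bucketMean k w' b →
      ∃ j : Fin (n / k), w ⟨b.val * (n / k) + j.val, bucket_index_lt b j⟩ ≠
        w' ⟨b.val * (n / k) + j.val, bucket_index_lt b j⟩ := by
    intro b hb
    by_contra! hcon
    exact hb (by simp only [bucketMean, hcon])
  -- If n / k = 0, all buckets are empty and all bucket means agree.
  rcases isEmpty_or_nonempty (Fin (n / k)) with hemp | hne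
  · rw [Finset.filter_false_of_mem]
    · simp
    · intro b _ hb
      exact hemp.elim (hex b hb).choose
  choose! j hj using hex
  refine Finset.card_le_card_of_injOn
    (fun b => ⟨b.val * (n / k) + (j b).val, bucket_index_lt b (j b)⟩) (fun b hb => ?_) ?_
  · simpa using hj b (by simpa using hb)
  · intro b _ b' _ hbb
    simp only [Fin.mk.injEq] at hbb
    have hpos : 0 < n / k := Fin.pos_iff_nonempty.2 hne
    have h1 : ∀ c : Fin k, (c.val * (n / k) + (j c).val) / (n / k) = c := by
      intro c
      rw [mul_comm, Nat.mul_add_div hpos, Nat.div_eq_of_lt (j c).isLt, add_zero]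
    exact Fin.ext (by rw [← h1 b, ← h1 b', hbb])

open Classical in
lemma isCorruption_momPreprocess {d n k : ℕ} {x t : Fin n → Vec d} {ρ : Equiv.Perm (Fin n)} {ε : ℝ}
    (h : (#{i | t i ≠ x (ρ i)} : ℝ) ≤ ε * k) (σ : Equiv.Perm (Fin n)) :
    IsCorruption ε (toMultiset (bucketMean k fun i => x (ρ (σ i)))) (momPreprocess k t σ) := by
  refine isCorruption_toMultiset (le_trans ?_ h)
  have h1 := card_bucketMean_ne_le (k := k) (fun i => t (σ i)) (fun i => x (ρ (σ i)))
  have h2 : #{i | t (σ i) ≠ x (ρ (σ i))} = #{i | t i ≠ x (ρ i)} := by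
    refine Finset.card_bij (fun i _ => σ i) (fun i hi => by simpa using hi)
      (fun i _ i' _ hii => σ.injective hii) fun i hi => ⟨σ.symm i, by simpa using hi, by simp⟩
  exact_mod_cast h2 ▸ h1

end Corruption

/-! ### Removing the adversary by averaging over permutations. -/

section Shuffle

open scoped Finset

open Classical in
/-- A uniform shuffle that is independent of the data undoes any data-dependent ordering: the
probability of a data-dependent event is bounded by that of the event for the original sample. -/
lemma measure_shuffle_le {n : ℕ} {Ω F α : Type*} [MeasurableSpace Ω] [MeasurableSpace F]
    [MeasurableSpace α] {Pr : Measure Ω} [IsProbabilityMeasure Pr] {P : Measure F}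
    [IsProbabilityMeasure P] {X : Fin n → Ω → F} {π : Ω → Equiv.Perm (Fin n)} {V : Ω → α}
    (hX : ∀ i, Measurable (X i)) (hlaw : ∀ i, HasLaw (X i) P Pr) (hind : iIndepFun X Pr)
    (hπ : Measurable π) (hπu : HasLaw π (uniformOn Set.univ) Pr) (hV : Measurable V)
    (hπV : IndepFun π V Pr) {bad : Equiv.Perm (Fin n) → Set α} (hbad : ∀ p, MeasurableSet (bad p))
    {B : Set (Fin n → F)} (hB : MeasurableSet B)
    (hcount : ∀ᵐ ω ∂Pr, #{p | V ω ∈ bad p} ≤ #{p : Equiv.Perm (Fin n) | (fun i => X (p i) ω) ∈ B}) :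
    Pr {ω | V ω ∈ bad (π ω)} ≤ Measure.pi (fun _ => P) B := by
  have hσ : ∀ p : Equiv.Perm (Fin n), Pr {ω | (fun i => X (p i) ω) ∈ B} =
      Measure.pi (fun _ => P) B := by
    intro p
    have h1 := (iIndepFun_iff_map_fun_eq_pi_map (fun i => (hX (p i)).aemeasurable)).1
      (hind.precomp p.injective)
    simp_rw [(hlaw _).map_eq] at h1
    rw [← h1, Measure.map_apply (by fun_prop) hB]
    rfl
  have hcard : (Fintype.card (Equiv.Perm (Fin n)) : ENNReal) ≠ 0 := by
    simp [Fintype.card_ne_zero]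
  have hunif : ∀ p, Pr (π ⁻¹' {p}) = (Fintype.card (Equiv.Perm (Fin n)) : ENNReal)⁻¹ := by
    intro p
    rw [← Measure.map_apply hπ (MeasurableSpace.measurableSet_top), hπu.map_eq, uniformOn_univ,
      Measure.count_singleton' MeasurableSpace.measurableSet_top, one_div]
  -- Both sums are expected numbers of permutations, so the pointwise count comparison integrates.
  -- Each term on the right equals the product measure of B, by exchangeability.
  have hsum : ∑ p, Pr (V ⁻¹' bad p) ≤
      ∑ p : Equiv.Perm (Fin n), Pr {ω | (fun i => X (p i) ω) ∈ B} := by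
    have hm1 : ∀ p, MeasurableSet (V ⁻¹' bad p) := fun p => hV (hbad p)
    have hm2 : ∀ p : Equiv.Perm (Fin n), MeasurableSet {ω | (fun i => X (p i) ω) ∈ B} := fun p =>
      (measurable_pi_lambda _ fun i => hX (p i)) hB
    simp_rw [← fun p => lintegral_indicator_one (μ := Pr) (hm1 p),
      ← fun p => lintegral_indicator_one (μ := Pr) (hm2 p)]
    rw [← lintegral_finsetSum _ fun p _ => measurable_one.indicator (hm1 p),
      ← lintegral_finsetSum _ fun p _ => measurable_one.indicator (hm2 p)]
    refine lintegral_mono_ae (hcount.mono fun ω hω => ?_)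
    simp only [Set.indicator_apply, Set.mem_preimage, Pi.one_apply, Set.mem_ofPred_eq,
      Finset.sum_boole]
    exact_mod_cast hω
  calc Pr {ω | V ω ∈ bad (π ω)} ≤ Pr (⋃ p, π ⁻¹' {p} ∩ V ⁻¹' bad p) :=
        measure_mono fun ω hω => Set.mem_iUnion.2 ⟨π ω, rfl, hω⟩
    _ ≤ ∑ p, Pr (π ⁻¹' {p} ∩ V ⁻¹' bad p) := measure_iUnion_fintype_le _ _
    _ = ∑ p, (Fintype.card (Equiv.Perm (Fin n)) : ENNReal)⁻¹ * Pr (V ⁻¹' bad p) := by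
        refine Finset.sum_congr rfl fun p _ => ?_
        rw [hπV.measure_inter_preimage_eq_mul _ _ MeasurableSpace.measurableSet_top (hbad p), hunif]
    _ = (Fintype.card (Equiv.Perm (Fin n)) : ENNReal)⁻¹ * ∑ p, Pr (V ⁻¹' bad p) := by
        rw [Finset.mul_sum]
    _ ≤ (Fintype.card (Equiv.Perm (Fin n)) : ENNReal)⁻¹ *
          ∑ p : Equiv.Perm (Fin n), Pr {ω | (fun i => X (p i) ω) ∈ B} := by gcongr
    _ = Measure.pi (fun _ => P) B := by
        simp_rw [hσ]
        rw [Finset.sum_const, nsmul_eq_mul, ← mul_assoc, Finset.card_univ,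
          ENNReal.inv_mul_cancel hcard (by simp), one_mul]

open Classical in
lemma measurableSet_card_ne_le {d n : ℕ} (ρ : Equiv.Perm (Fin n)) (c : ℝ) :
    MeasurableSet {v : (Fin n → Vec d) × (Fin n → Vec d) |
      (#{i | v.2 i ≠ v.1 (ρ i)} : ℝ) ≤ c} := by
  refine measurableSet_le ?_ measurable_const
  simp_rw [Finset.card_filter]
  push_cast
  refine Finset.measurable_sum _ fun i _ => Measurable.ite ?_ measurable_const measurable_const
  exact (measurableSet_eq_fun (f := fun v : (Fin n → Vec d) × (Fin n → Vec d) => v.2 i)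
    (g := fun v => v.1 (ρ i)) (by fun_prop) (by fun_prop)).compl

/-- Reduction of the corrupted, shuffled sample to the clean sample in its original order. -/
lemma measure_corrupted_le {d n k : ℕ} {Ω : Type*} [MeasurableSpace Ω]
    {Pr : Measure Ω} [IsProbabilityMeasure Pr] {P : Measure (Vec d)} [IsProbabilityMeasure P]
    {X : Fin n → Ω → Vec d} {T : Ω → Fin n → Vec d} {π : Ω → Equiv.Perm (Fin n)} {ε η : ℝ}
    (hX : ∀ i, Measurable (X i)) (hlaw : ∀ i, HasLaw (X i) P Pr) (hind : iIndepFun X Pr)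
    (hT : Measurable T)
    (hcor : ∀ᵐ ω ∂Pr, IsCorruption ε (toMultiset fun i => X i ω) (toMultiset (T ω)))
    (hπ : Measurable π) (hπu : HasLaw π (uniformOn Set.univ) Pr)
    (hπV : IndepFun π (fun ω => ((fun i => X i ω), T ω)) Pr) (hε : ε * n ≤ η * k)
    (good : Multiset (Vec d) → Prop) :
    Pr {ω | ¬ ∃ S, IsCorruption η S (momPreprocess k (T ω) (π ω)) ∧ good S} ≤
      Measure.pi (fun _ => P) {x : Fin n → Vec d | ¬ good (toMultiset (bucketMean k x))} := by
  classical
  -- The failure set need not be measurable; a measurable hull has the same outer measure.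
  set B := toMeasurable (Measure.pi fun _ => P)
    {x : Fin n → Vec d | ¬ good (toMultiset (bucketMean k x))} with hBdef
  have hB : MeasurableSet B := measurableSet_toMeasurable _ _
  set ok : Equiv.Perm (Fin n) → Set ((Fin n → Vec d) × (Fin n → Vec d)) := fun ρ =>
    {v | (#{i | v.2 i ≠ v.1 (ρ i)} : ℝ) ≤ ε * n} with hok
  have hokm : ∀ ρ, MeasurableSet (ok ρ) := fun ρ => measurableSet_card_ne_le ρ _
  -- Intersecting over all matchings ρ avoids a measurable choice of the one that aligns T with X.
  set bad : Equiv.Perm (Fin n) → Set ((Fin n → Vec d) × (Fin n → Vec d)) := fun p =>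
    ⋂ ρ, (ok ρ)ᶜ ∪ {v | (fun i => v.1 (ρ (p i))) ∈ B} with hbad
  have hbadm : ∀ p, MeasurableSet (bad p) := fun p =>
    MeasurableSet.iInter fun ρ => (hokm ρ).compl.union
      ((by fun_prop : Measurable fun v : (Fin n → Vec d) × (Fin n → Vec d) =>
        fun i => v.1 (ρ (p i))) hB)
  have h := measure_shuffle_le (V := fun ω => ((fun i => X i ω), T ω)) hX hlaw hind hπ hπu
    (by fun_prop) hπV hbadm hB (hcor.mono fun ω hω => by
      obtain ⟨ρ, hρ⟩ := exists_perm_of_isCorruption hω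
      -- For a fixed outcome ρ is fixed, and p ↦ ρ ∘ p sends bad shuffles of T injectively to
      -- orderings of X in B.
      refine Finset.card_le_card_of_injOn (fun p => p.trans ρ) (fun p hp => ?_)
        fun p _ p' _ hpp => ?_
      · simp only [Finset.coe_filter, Finset.mem_univ, true_and, Set.mem_ofPred_eq, hbad,
          Set.mem_iInter, Set.mem_union, Set.mem_compl_iff] at hp ⊢
        exact (hp ρ).resolve_left (not_not.2 (by simp only [hok, Set.mem_ofPred_eq]; convert hρ))
      · refine Equiv.ext fun i => ?_
        simpa using congrArg (fun e : Equiv.Perm (Fin n) => e i) hpp)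
  rw [hBdef, measure_toMeasurable] at h
  refine (measure_mono fun ω hω => ?_).trans h
  simp only [Set.mem_ofPred_eq, hbad, Set.mem_iInter, Set.mem_union, Set.mem_compl_iff] at hω ⊢
  intro ρ
  by_cases hρ : ((fun i => X i ω), T ω) ∈ ok ρ
  · refine Or.inr (subset_toMeasurable _ _ fun hg => hω ⟨_, ?_, hg⟩)
    exact isCorruption_momPreprocess (x := fun i => X i ω) (le_trans hρ hε) (π ω)
  · exact Or.inl hρ

end Shuffle

/-! ### The covariance form, its norm bound and its Gaussian average. -/

section CovarianceMatrix

open scoped RealInnerProductSpace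

variable {d : ℕ} {P : Measure (Vec d)} [IsProbabilityMeasure P]

lemma covMat_apply (hP : MemLp id 2 P) (i j : Fin d) :
    covMat P i j = covarianceBilin P (EuclideanSpace.single i 1) (EuclideanSpace.single j 1) := by
  rw [covarianceBilin_apply_eq_cov hP]
  simp [covMat, EuclideanSpace.inner_single_left]

lemma covarianceBilin_eq_sum (hP : MemLp id 2 P) (u v : Vec d) :
    covarianceBilin P u v = ∑ i, ∑ j, u i * v j * covMat P i j := by
  have h : ∀ w : Vec d, w = ∑ i, w i • EuclideanSpace.single i (1 : ℝ) := by
    intro w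
    ext j
    simp [Finset.sum_apply, Pi.single_apply]
  conv_lhs => rw [h u, h v]
  simp only [map_sum, sum_apply, map_smul, smul_apply, smul_eq_mul, Finset.mul_sum]
  rw [Finset.sum_comm]
  refine Finset.sum_congr rfl fun i _ => Finset.sum_congr rfl fun j _ => ?_
  rw [covMat_apply hP]
  ring

lemma covarianceBilin_self_le (hP : MemLp id 2 P) (u : Vec d) :
    covarianceBilin P u u ≤ specNorm (covMat P) * ‖u‖ ^ 2 := by
  have h : covarianceBilin P u u =
      ⟪u, Matrix.toEuclideanCLM (n := Fin d) (𝕜 := ℝ) (covMat P) u⟫ := by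
    rw [covarianceBilin_eq_sum hP, Matrix.inner_toEuclideanCLM]
    simp only [dotProduct, Matrix.mulVec, Finset.mul_sum]
    refine Finset.sum_congr rfl fun i _ => Finset.sum_congr rfl fun j _ => ?_
    ring
  rw [h]
  refine (real_inner_le_norm _ _).trans ?_
  have := ContinuousLinearMap.le_opNorm
    (Matrix.toEuclideanCLM (n := Fin d) (𝕜 := ℝ) (covMat P)) u
  rw [specNorm]
  nlinarith [norm_nonneg u]

lemma specNorm_nonneg (M : Matrix (Fin d) (Fin d) ℝ) : 0 ≤ specNorm M := norm_nonneg _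

lemma trace_covMat_nonneg (hP : MemLp id 2 P) : 0 ≤ (covMat P).trace := by
  refine Finset.sum_nonneg fun i _ => ?_
  rw [Matrix.diag_apply, covMat_apply hP]
  exact covarianceBilin_self_nonneg _

lemma integrable_mul_stdGaussian (i j : Fin d) :
    Integrable (fun x : Vec d => x i * x j) (stdGaussian (Vec d)) := by
  have h : ∀ i, MemLp (fun x : Vec d => x i) 2 (stdGaussian (Vec d)) := fun i =>
    IsGaussian.memLp_dual (stdGaussian (Vec d)) (EuclideanSpace.proj i) 2 (by simp)
  exact (h i).integrable_mul (h j)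

lemma integral_mul_stdGaussian (i j : Fin d) :
    ∫ x : Vec d, x i * x j ∂stdGaussian (Vec d) = if i = j then 1 else 0 := by
  have h := covarianceBilin_apply (μ := stdGaussian (Vec d)) IsGaussian.memLp_two_id
    (EuclideanSpace.single i 1) (EuclideanSpace.single j 1)
  rw [covarianceBilin_stdGaussian] at h
  simp only [id_eq, integral_id_stdGaussian, sub_zero, EuclideanSpace.inner_single_left] at h
  rw [innerSL_apply_apply ℝ, EuclideanSpace.inner_single_left] at h
  simpa [Pi.single_apply] using h.symm

/-- The cross term is linear in x and averages to zero, while E[x xᵀ] = I turns the quadratic term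
into the trace. This is how the stable rank enters. -/
lemma integrable_covarianceBilin_shift (hP : MemLp id 2 P) (u : Vec d) :
    Integrable (fun x => covarianceBilin P (u + x) (u + x)) (stdGaussian (Vec d)) ∧
      ∫ x, covarianceBilin P (u + x) (u + x) ∂stdGaussian (Vec d) =
        covarianceBilin P u u + (covMat P).trace := by
  have hlin : ∀ L : StrongDual ℝ (Vec d), Integrable (fun x => L x) (stdGaussian (Vec d)) :=
    fun L => IsGaussian.integrable_dual _ L
  have hq : Integrable (fun x => covarianceBilin P x x) (stdGaussian (Vec d)) := by
    simp_rw [fun x : Vec d => covarianceBilin_eq_sum hP x x]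
    exact integrable_finsetSum _ fun i _ => integrable_finsetSum _ fun j _ =>
      (integrable_mul_stdGaussian i j).mul_const _
  have hqi : ∫ x, covarianceBilin P x x ∂stdGaussian (Vec d) = (covMat P).trace := by
    simp_rw [fun x : Vec d => covarianceBilin_eq_sum hP x x]
    refine (integral_finsetSum _ fun i _ => integrable_finsetSum _ fun j _ =>
      (integrable_mul_stdGaussian i j).mul_const _).trans ?_
    refine Finset.sum_congr rfl fun i _ => ?_
    refine (integral_finsetSum _ fun j _ => (integrable_mul_stdGaussian i j).mul_const _).trans ?_
    simp_rw [integral_mul_const, integral_mul_stdGaussian]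
    simp
  have hexp : ∀ x, covarianceBilin P (u + x) (u + x) =
      covarianceBilin P u u + 2 * covarianceBilin P u x + covarianceBilin P x x := by
    intro x
    simp only [map_add, add_apply]
    rw [covarianceBilin_comm x u]
    ring
  have h2 := (hlin (covarianceBilin P u)).const_mul 2
  have h3 : Integrable (fun x => covarianceBilin P u u + 2 * covarianceBilin P u x)
      (stdGaussian (Vec d)) := (integrable_const _).add h2
  simp_rw [hexp]
  refine ⟨h3.add hq, ?_⟩
  rw [integral_add h3 hq, integral_add (integrable_const _) h2, integral_const_mul,
    integral_strongDual_stdGaussian, hqi]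
  simp

end CovarianceMatrix

/-! ### Independence and tails of the bucket means. -/

section Buckets

open scoped RealInnerProductSpace

/-- Disjoint blocks of independent random variables are independent. -/
lemma iIndepFun_curry {ι κ Ω F : Type*} [MeasurableSpace Ω] [MeasurableSpace F] {Pr : Measure Ω}
    {X : ι × κ → Ω → F} (hX : ∀ p, Measurable (X p)) (h : iIndepFun X Pr) :
    iIndepFun (fun i ω j => X (i, j) ω) Pr := by
  have := h.isProbabilityMeasure
  have : ∀ i j, IsProbabilityMeasure (Pr.map (X (i, j))) :=
    fun i j => Measure.isProbabilityMeasure_map (hX _).aemeasurable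
  have hcomp : (MeasurableEquiv.curry ι κ F) ∘ (fun ω p => X p ω) = fun ω i j => X (i, j) ω := by
    ext; simp
  rw [iIndepFun_iff_map_fun_eq_infinitePi_map (by fun_prop), ← hcomp,
    ← Measure.map_map (by fun_prop) (by fun_prop),
    (iIndepFun_iff_map_fun_eq_infinitePi_map (by fun_prop)).1 h,
    Measure.infinitePi_map_curry (fun i j => Pr.map (X (i, j)))]
  congr 1 with i : 1
  exact ((iIndepFun_iff_map_fun_eq_infinitePi_map (by fun_prop)).1
    (h.precomp (Prod.mk_right_injective i))).symm

variable {d n k : ℕ} {P : Measure (Vec d)} [IsProbabilityMeasure P]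

lemma bucket_index_injective : Function.Injective fun p : Fin k × Fin (n / k) =>
    (⟨p.1.val * (n / k) + p.2.val, bucket_index_lt p.1 p.2⟩ : Fin n) := by
  rintro ⟨b, j⟩ ⟨b', j'⟩ h
  simp only [Fin.mk.injEq] at h
  have hpos : 0 < n / k := j.pos
  have h1 : ∀ (c : Fin k) (i : Fin (n / k)), (c.val * (n / k) + i.val) / (n / k) = c := by
    intro c i
    rw [mul_comm, Nat.mul_add_div hpos, Nat.div_eq_of_lt i.isLt, add_zero]
  have hb : b = b' := Fin.ext (by rw [← h1 b j, ← h1 b' j', h])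
  subst hb
  simpa [Fin.ext_iff] using h

lemma measurable_bucketMean (b : Fin k) :
    Measurable fun x : Fin n → Vec d => bucketMean k x b := by
  unfold bucketMean
  fun_prop

lemma iIndepFun_bucketMean_sub (μ : Vec d) :
    iIndepFun (fun (b : Fin k) (x : Fin n → Vec d) => bucketMean k x b - μ)
      (Measure.pi fun _ => P) := by
  have h1 : iIndepFun (fun (i : Fin n) (x : Fin n → Vec d) => x i) (Measure.pi fun _ => P) :=
    iIndepFun_pi (X := fun _ => id) fun _ => aemeasurable_id
  have h2 := iIndepFun_curry (X := fun (p : Fin k × Fin (n / k)) (x : Fin n → Vec d) =>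
      x ⟨p.1.val * (n / k) + p.2.val, bucket_index_lt p.1 p.2⟩) (by fun_prop)
    (h1.precomp (g := fun p : Fin k × Fin (n / k) =>
      (⟨p.1.val * (n / k) + p.2.val, bucket_index_lt p.1 p.2⟩ : Fin n)) bucket_index_injective)
  exact h2.comp (fun _ y => ((n / k : ℕ) : ℝ)⁻¹ • ∑ j, y j - μ) (fun _ => by fun_prop)

/-- Chebyshev's inequality for a projection of a bucket mean. -/
lemma measureReal_lt_abs_inner_bucketMean_le (hP : MemLp id 2 P) (hm : 0 < n / k) (θ : Vec d)
    (b : Fin k) {q : ℝ} (hq : 0 ≤ q) (hq' : q = 0 → covarianceBilin P θ θ = 0) :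
    (Measure.pi fun _ : Fin n => P).real {x | q < |⟪θ, bucketMean k x b - ∫ x, x ∂P⟫|} ≤
      covarianceBilin P θ θ / ((n / k : ℕ) * q ^ 2) := by
  set Pn := Measure.pi fun _ : Fin n => P with hPn
  set m : ℝ := ((n / k : ℕ) : ℝ) with hmdef
  have hm0 : 0 < m := by rw [hmdef]; exact_mod_cast hm
  have hθ : MemLp (fun x : Vec d => ⟪θ, x⟫) 2 P := by
    simpa using hP.const_inner (𝕜 := ℝ) θ
  set idx : Fin (n / k) → Fin n := fun j => ⟨b.val * (n / k) + j.val, bucket_index_lt b j⟩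
  have hidx : Function.Injective idx := fun j j' h => by
    simpa [idx, Fin.ext_iff] using h
  set Y : Fin (n / k) → (Fin n → Vec d) → ℝ := fun j x => ⟪θ, x (idx j)⟫ with hY
  have hmp : ∀ i, MeasurePreserving (Function.eval i) Pn P := fun i => measurePreserving_eval _ i
  have hYm : ∀ j, MemLp (Y j) 2 Pn := fun j => hθ.comp_measurePreserving (hmp (idx j))
  have hYv : ∀ j, Var[Y j; Pn] = covarianceBilin P θ θ := by
    intro j
    rw [covarianceBilin_self hP, ← (hmp (idx j)).map_eq,
      variance_map (by fun_prop) (hmp (idx j)).aemeasurable]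
    rfl
  have hYi : ∀ j, ∫ x, Y j x ∂Pn = ⟪θ, ∫ x, x ∂P⟫ := by
    intro j
    have hint : Integrable (fun x : Vec d => x) P := hP.integrable (by simp)
    rw [← integral_inner hint, ← (hmp (idx j)).map_eq,
      integral_map (hmp (idx j)).aemeasurable (by fun_prop)]
  have hindY : iIndepFun Y Pn := by
    have h1 : iIndepFun (fun (i : Fin n) (x : Fin n → Vec d) => x i) Pn :=
      iIndepFun_pi (X := fun _ => id) fun _ => aemeasurable_id
    exact (h1.precomp hidx).comp (fun _ y => ⟪θ, y⟫) fun _ => by fun_prop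
  set W : (Fin n → Vec d) → ℝ := fun x => m⁻¹ * (∑ j, Y j) x with hW
  have hWm : MemLp W 2 Pn := (memLp_finsetSum' _ fun j _ => hYm j).const_mul _
  have hWv : Var[W; Pn] = covarianceBilin P θ θ / m := by
    rw [hW, variance_const_mul, IndepFun.variance_sum (fun j _ => hYm j)
      fun i _ j _ hij => hindY.indepFun hij]
    simp_rw [hYv]
    simp only [Finset.sum_const, Finset.card_univ, Fintype.card_fin, nsmul_eq_mul]
    rw [← hmdef]
    field_simp
  have hWi : ∫ x, W x ∂Pn = ⟪θ, ∫ x, x ∂P⟫ := by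
    simp only [hW, Finset.sum_apply]
    rw [integral_const_mul, integral_finsetSum _ fun j _ => (hYm j).integrable (by simp)]
    simp_rw [hYi]
    simp only [Finset.sum_const, Finset.card_univ, Fintype.card_fin, nsmul_eq_mul]
    rw [← hmdef]
    field_simp
  have hin : ∀ x, ⟪θ, bucketMean k x b - ∫ x, x ∂P⟫ = W x - ∫ x, W x ∂Pn := by
    intro x
    rw [hWi, inner_sub_right, bucketMean, inner_smul_right, inner_sum]
    simp [hW, hY, idx, hmdef]
  simp_rw [hin]
  -- For q = 0 the right side is 0 by the division convention; the variance then vanishes, so the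
  -- projection is almost surely constant.
  rcases hq.eq_or_lt with rfl | hq0
  · have h0 : evariance W Pn = 0 := by
      rw [← hWm.ofReal_variance_eq, hWv, hq' rfl]; simp
    rw [evariance_eq_zero_iff hWm.1.aemeasurable] at h0
    have : Pn {x | 0 < |W x - ∫ x, W x ∂Pn|} = 0 := by
      refine measure_mono_null (fun x hx => ?_) (ae_iff.1 h0)
      simp only [Set.mem_ofPred_eq, abs_pos, sub_ne_zero] at hx ⊢
      exact hx
    rw [measureReal_def, this]
    simp
  · have hcheb := meas_ge_le_variance_div_sq hWm hq0
    rw [hWv] at hcheb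
    have h0 : 0 ≤ covarianceBilin P θ θ / m / q ^ 2 :=
      div_nonneg (div_nonneg (covarianceBilin_self_nonneg _) hm0.le) (sq_nonneg _)
    rw [← div_div]
    refine le_trans ?_ (ENNReal.toReal_le_of_le_ofReal h0 hcheb)
    refine measureReal_mono fun x hx => ?_
    rw [Set.mem_ofPred_eq] at hx ⊢
    exact hx.le

open scoped Finset in
open Classical in
/-- With high probability, in every direction few centered bucket means have a large projection. -/
lemma measure_card_large_bucketMean_le (hP : MemLp id 2 P) (hm : 0 < n / k) {q β : ℝ}
    (hq : 0 ≤ q) (hβ : 0 < β) (hq' : q = 0 → specNorm (covMat P) = 0) (t : ℝ) :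
    (Measure.pi fun _ : Fin n => P) {x | ¬ ∀ y : Vec d,
      (#{b : Fin k | q < |⟪y, bucketMean k x b - ∫ x, x ∂P⟫|} : ℝ) ≤
        (2 * t + 4 * k * ((covMat P).trace / (β * ((n / k : ℕ) * q ^ 2)))) +
        (β + 4 * k * (specNorm (covMat P) / ((n / k : ℕ) * q ^ 2))) * ‖y‖ ^ 2} ≤
      ENNReal.ofReal (Real.exp (-t)) := by
  set m : ℝ := ((n / k : ℕ) : ℝ) with hmdef
  have hm0 : 0 < m := by rw [hmdef]; exact_mod_cast hm
  have hsq : 0 < √β := Real.sqrt_pos.2 hβ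
  have hsq2 : √β ^ 2 = β := Real.sq_sqrt hβ.le
  -- Direction and threshold are both scaled by √β, which amounts to smearing y with variance 1/β.
  -- This trades the entropy term β‖y‖² against the trace term tr Σ / β.
  have key := measure_exists_card_large_inner_gt_le (Pr := Measure.pi fun _ : Fin n => P)
    (Z := fun (b : Fin k) x => bucketMean k x b - ∫ x, x ∂P)
    (fun b => (measurable_bucketMean b).sub_const _) (iIndepFun_bucketMean_sub _)
    (q := √β * q) (Q := fun θ => covarianceBilin P θ θ / (m * (√β * q) ^ 2))
    (by fun_prop)
    (fun θ b => measureReal_lt_abs_inner_bucketMean_le hP hm θ b (by positivity) fun h => by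
      have h1 := covarianceBilin_self_le hP θ
      rw [hq' (by simpa [hsq.ne'] using h), zero_mul] at h1
      exact le_antisymm h1 (covarianceBilin_self_nonneg _))
    (fun u => (integrable_covarianceBilin_shift hP u).1.div_const _) t
  refine (measure_mono fun x hx => ?_).trans key
  simp only [Set.mem_ofPred_eq, not_forall, not_le] at hx ⊢
  obtain ⟨y, hy⟩ := hx
  refine ⟨√β • y, ?_⟩
  have hset : (Finset.univ.filter fun b : Fin k =>
      √β * q < |⟪√β • y, bucketMean k x b - ∫ x, x ∂P⟫|) =
      Finset.univ.filter fun b : Fin k => q < |⟪y, bucketMean k x b - ∫ x, x ∂P⟫| := by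
    ext b
    simp [real_inner_smul_left, abs_mul, abs_of_pos hsq, hsq]
  rw [hset]
  refine lt_of_le_of_lt ?_ hy
  rw [integral_div, (integrable_covarianceBilin_shift hP _).2, norm_smul, mul_pow, mul_pow,
    Real.norm_eq_abs, sq_abs, hsq2, Fintype.card_fin]
  have h1 := covarianceBilin_self_le hP y
  have h2 : covarianceBilin P (√β • y) (√β • y) = β * covarianceBilin P y y := by
    simp only [map_smul, smul_apply, smul_eq_mul]
    rw [← mul_assoc, ← sq, hsq2]
  rw [h2]
  have h3 : (β * covarianceBilin P y y + (covMat P).trace) / (m * (β * q ^ 2)) =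
      covarianceBilin P y y / (m * q ^ 2) + (covMat P).trace / (β * (m * q ^ 2)) := by
    rw [add_div, show m * (β * q ^ 2) = β * (m * q ^ 2) by ring, mul_div_mul_left _ _ hβ.ne']
  have h4 : covarianceBilin P y y / (m * q ^ 2) ≤
      specNorm (covMat P) / (m * q ^ 2) * ‖y‖ ^ 2 := by
    rw [div_mul_eq_mul_div]
    gcongr
  have h5 := mul_le_mul_of_nonneg_left h4 (by positivity : (0 : ℝ) ≤ 4 * k)
  rw [h3]
  linarith

end Buckets

/-! ### Stability from directional second moments. -/

section Stability

open scoped RealInnerProductSpace Finset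

variable {d : ℕ}

lemma exists_eq_toMultiset {E : Type*} (R : Multiset E) :
    ∃ (N : ℕ) (f : Fin N → E), R = toMultiset f :=
  ⟨_, _, ((toMultiset_get R.toList (Multiset.length_toList R)).trans (Multiset.coe_toList R)).symm⟩

lemma sum_map_toMultiset {E F : Type*} [AddCommMonoid F] {n : ℕ} (f : Fin n → E) (g : E → F) :
    ((toMultiset f).map g).sum = ∑ i, g (f i) := by
  rw [toMultiset, Multiset.map_map]
  rfl

/-- A bound for the second moments in all directions bounds the deviation of the mean. -/
lemma norm_msMean_sub_sq_le {R : Multiset (Vec d)} (hR : 0 < R.card) {μ : Vec d} {G : ℝ}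
    (hG : 0 ≤ G) (h : ∀ y : Vec d, (R.map fun x => ⟪y, x - μ⟫ ^ 2).sum ≤ G * R.card * ‖y‖ ^ 2) :
    ‖msMean R - μ‖ ^ 2 ≤ G := by
  obtain ⟨N, f, hf⟩ := exists_eq_toMultiset R
  have hcard : (toMultiset f).card = N := by simp [toMultiset]
  rw [hf, hcard] at hR h
  have hN : (0 : ℝ) < N := by exact_mod_cast hR
  set w := msMean R - μ with hw
  have hw' : w = (N : ℝ)⁻¹ • ∑ i, (f i - μ) := by
    rw [hw, hf, msMean, hcard, Finset.sum_sub_distrib, smul_sub]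
    simp only [toMultiset, Finset.sum_const, Finset.card_univ, Fintype.card_fin]
    rw [← Nat.cast_smul_eq_nsmul ℝ, smul_smul, inv_mul_cancel₀ hN.ne', one_smul]
    rfl
  have h1 : ∑ i, ⟪w, f i - μ⟫ ^ 2 ≤ G * N * ‖w‖ ^ 2 := by
    simpa only [sum_map_toMultiset] using h w
  have h2 : ∑ i, ⟪w, f i - μ⟫ = N * ‖w‖ ^ 2 := by
    have h0 : ∑ i, (f i - μ) = (N : ℝ) • w := by
      rw [hw', smul_smul, mul_inv_cancel₀ hN.ne', one_smul]
    rw [← inner_sum, h0, inner_smul_right, real_inner_self_eq_norm_sq]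
  have h3 := sq_sum_le_card_mul_sum_sq (s := Finset.univ) (f := fun i => ⟪w, f i - μ⟫)
  rw [h2, Finset.card_univ, Fintype.card_fin] at h3
  rcases eq_or_ne w 0 with h0 | h0
  · simpa [h0] using hG
  · have hpos : 0 < ‖w‖ ^ 2 := by positivity
    have h4 : (N * ‖w‖ ^ 2) * (N * ‖w‖ ^ 2) ≤ G * (N * (N * ‖w‖ ^ 2)) := by nlinarith
    have h5 : ‖w‖ ^ 2 * (N * (N * ‖w‖ ^ 2)) ≤ G * (N * (N * ‖w‖ ^ 2)) := by linarith
    exact le_of_mul_le_mul_right h5 (by positivity)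

/-- A bound for the second moments in all directions bounds the second moment matrix. -/
lemma specNorm_secondMoment_le {R : Multiset (Vec d)} (hR : 0 < R.card) {μ : Vec d} {G : ℝ}
    (hG : 0 ≤ G) (h : ∀ y : Vec d, (R.map fun x => ⟪y, x - μ⟫ ^ 2).sum ≤ G * R.card * ‖y‖ ^ 2) :
    specNorm (secondMoment μ R) ≤ G := by
  obtain ⟨N, f, hf⟩ := exists_eq_toMultiset R
  have hcard : (toMultiset f).card = N := by simp [toMultiset]
  rw [hf, hcard] at hR h
  have hN : (0 : ℝ) < N := by exact_mod_cast hR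
  have hb : ∀ y, ∑ i, ⟪y, f i - μ⟫ ^ 2 ≤ G * N * ‖y‖ ^ 2 := by
    intro y
    simpa only [sum_map_toMultiset] using h y
  have hA : secondMoment μ R =
      (N : ℝ)⁻¹ • ∑ i, Matrix.vecMulVec (f i - μ).ofLp (f i - μ).ofLp := by
    rw [hf, secondMoment, hcard, sum_map_toMultiset]
  refine ContinuousLinearMap.opNorm_le_bound _ hG fun y => ?_
  set w := Matrix.toEuclideanCLM (n := Fin d) (𝕜 := ℝ) (secondMoment μ R) y with hw
  -- Testing the image w of y against itself lets Cauchy–Schwarz use the bound in the directions w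
  -- and y.
  have hwy : N * ‖w‖ ^ 2 = ∑ i, ⟪w, f i - μ⟫ * ⟪y, f i - μ⟫ := by
    have h1 : ‖w‖ ^ 2 = w.ofLp ⬝ᵥ (secondMoment μ R).mulVec y.ofLp := by
      rw [← Matrix.inner_toEuclideanCLM, ← hw, real_inner_self_eq_norm_sq]
    rw [h1, hA, Matrix.smul_mulVec, dotProduct_smul, Matrix.sum_mulVec, dotProduct_sum, smul_eq_mul,
      ← mul_assoc, mul_inv_cancel₀ hN.ne', one_mul]
    refine Finset.sum_congr rfl fun i _ => ?_
    rw [Matrix.vecMulVec_mulVec, dotProduct_smul]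
    simp [EuclideanSpace.inner_eq_star_dotProduct, dotProduct_comm, mul_comm]
  have hcs := Finset.sum_mul_sq_le_sq_mul_sq Finset.univ (fun i => ⟪w, f i - μ⟫)
    fun i => ⟪y, f i - μ⟫
  rw [← hwy] at hcs
  have h2 : (N * ‖w‖ ^ 2) ^ 2 ≤ (G * N * ‖w‖ ^ 2) * (G * N * ‖y‖ ^ 2) :=
    hcs.trans (mul_le_mul (hb w) (hb y) (Finset.sum_nonneg fun _ _ => sq_nonneg _) (by positivity))
  rcases eq_or_ne w 0 with h0 | h0
  · rw [h0, norm_zero]; positivity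
  · have hpos : 0 < ‖w‖ := norm_pos_iff.2 h0
    have h3 : (‖w‖) ^ 2 * (N * ‖w‖) ^ 2 ≤ (G * ‖y‖) ^ 2 * (N * ‖w‖) ^ 2 := by linarith
    exact le_of_sq_le_sq (le_of_mul_le_mul_right h3 (by positivity)) (by positivity)

/-- Bounded second moments in all directions imply stability. -/
lemma isStableSet_of_sum_inner_sq_le {k : ℕ} (hk : 1 ≤ k) {Y : Fin k → Vec d} {s : Finset (Fin k)}
    {μ : Vec d} {q v δ : ℝ} (hs : 0.95 * (k : ℝ) ≤ #s)
    (h : ∀ y : Vec d, ∑ b ∈ s, ⟪y, Y b - μ⟫ ^ 2 ≤ 4 * q ^ 2 * k * ‖y‖ ^ 2)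
    (hv : 0 ≤ v) (hδ : 1 ≤ δ) (hq : 5 * q ^ 2 ≤ v * δ ^ 2) :
    IsStableSet 0.1 δ μ v (s.val.map Y) := by
  refine ⟨by norm_num, by norm_num, by linarith, fun R hR hcard => ?_⟩
  have hk' : (1 : ℝ) ≤ k := by exact_mod_cast hk
  rw [Multiset.card_map, Finset.card_val] at hcard
  -- 0.9 · 0.95 = 0.855, and 4 / 0.855 < 5 explains the constant 5.
  have hRk : 0.855 * (k : ℝ) ≤ R.card := by linarith
  have hR0 : 0 < R.card := by
    have : (0 : ℝ) < R.card := by linarith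
    exact_mod_cast this
  have hb : ∀ y : Vec d, (R.map fun x => ⟪y, x - μ⟫ ^ 2).sum ≤ 5 * q ^ 2 * R.card * ‖y‖ ^ 2 := by
    intro y
    obtain ⟨D, hD⟩ := Multiset.le_iff_exists_add.1 hR
    have h1 : (R.map fun x => ⟪y, x - μ⟫ ^ 2).sum ≤ ∑ b ∈ s, ⟪y, Y b - μ⟫ ^ 2 := by
      have h2 : ∑ b ∈ s, ⟪y, Y b - μ⟫ ^ 2 =
          ((s.val.map Y).map fun x => ⟪y, x - μ⟫ ^ 2).sum := by
        simp
      rw [h2, hD, Multiset.map_add, Multiset.sum_add]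
      refine le_add_of_nonneg_right (Multiset.sum_nonneg fun a ha => ?_)
      obtain ⟨x, -, rfl⟩ := Multiset.mem_map.1 ha
      positivity
    refine (h1.trans (h y)).trans ?_
    gcongr ?_ * _
    nlinarith [sq_nonneg q]
  have hG : 0 ≤ 5 * q ^ 2 := by positivity
  constructor
  · refine le_of_sq_le_sq ?_ (by positivity)
    rw [mul_pow, Real.sq_sqrt hv]
    exact (norm_msMean_sub_sq_le hR0 hG hb).trans hq
  · have h1 := specNorm_secondMoment_le hR0 hG hb
    -- No cancellation with v • 1 is needed: each of the two terms is at most v δ², and 10 v δ² is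
    -- allowed.
    have h2 : specNorm (secondMoment μ R - v • (1 : Matrix (Fin d) (Fin d) ℝ)) ≤
        specNorm (secondMoment μ R) + v := by
      unfold specNorm
      rw [map_sub, map_smul, map_one]
      refine (norm_sub_le _ _).trans (add_le_add_right ?_ _)
      rw [norm_smul, Real.norm_of_nonneg hv]
      exact mul_le_of_le_one_right hv ContinuousLinearMap.norm_id_le
    have h3 : v ≤ v * δ ^ 2 := le_mul_of_one_le_right hv (one_le_pow₀ hδ)
    have h4 : v * δ ^ 2 / 0.1 = 10 * (v * δ ^ 2) := by norm_num; ring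
    linarith

end Stability

/-! ### Choice of parameters and conclusion. -/

section Main

open scoped RealInnerProductSpace Finset

variable {d n k : ℕ} {P : Measure (Vec d)} [IsProbabilityMeasure P]

/-- The bucket means of an i.i.d. sample contain a large stable subset, except with exponentially
small probability. -/
lemma measure_not_exists_stable_le (hP : MemLp id 2 P) (hk : 1 ≤ k) (hkn : k ≤ n) :
    (Measure.pi fun _ : Fin n => P) {x | ¬ ∃ S' ≤ toMultiset (bucketMean k x),
      0.95 * (k : ℝ) ≤ S'.card ∧
      IsStableSet 0.1 (20000 * (√(stableRank (covMat P) / k) + 1)) (∫ x, x ∂P)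
        (k * specNorm (covMat P) / n) S'} ≤ ENNReal.ofReal (Real.exp (-(k / 2000))) := by
  classical
  have hm : 0 < n / k := Nat.div_pos hkn hk
  set m : ℝ := ((n / k : ℕ) : ℝ) with hmdef
  have hm0 : 0 < m := by rw [hmdef]; exact_mod_cast hm
  have hk0 : (0 : ℝ) < k := by exact_mod_cast hk
  have hn0 : (0 : ℝ) < n := by exact_mod_cast hk.trans hkn
  set s := specNorm (covMat P) with hsdef
  set r := (covMat P).trace with hrdef
  have hs0 : 0 ≤ s := specNorm_nonneg _
  have hr0 : 0 ≤ r := trace_covMat_nonneg hP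
  have hsr : s = 0 → r = 0 := by
    intro h
    have h1 : covMat P = 0 := by
      rw [hsdef, specNorm, norm_eq_zero] at h
      simpa using h
    rw [hrdef, h1, Matrix.trace_zero]
  set D := s + r / k with hD
  have hD0 : 0 ≤ D := by positivity
  -- D/m bounds, up to constants, the variance of a projection smeared at scale β = k/2000; the
  -- large factor makes the outlier fraction small.
  set q := √(20000000 * D / m) with hqdef
  have hq2 : q ^ 2 = 20000000 * D / m := Real.sq_sqrt (by positivity)
  have hmq : m * q ^ 2 = 20000000 * D := by rw [hq2]; field_simp
  have hrk : 0 ≤ r / k := by positivity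
  have hnm : (n : ℝ) ≤ 2 * k * m := by
    have h1 : n < k * (n / k) + k := Nat.lt_mul_div_succ n hk |>.trans_eq (by ring)
    have h2 : k ≤ k * (n / k) := Nat.le_mul_of_pos_right k hm
    have h3 : n ≤ 2 * k * (n / k) := by linarith
    rw [hmdef]; exact_mod_cast h3
  have hq' : q = 0 → s = 0 := by
    intro h
    rw [h] at hmq
    linarith
  have key := measure_card_large_bucketMean_le (n := n) (k := k) (q := q) (β := k / 2000) hP hm
    (Real.sqrt_nonneg _) (by positivity) hq' (k / 2000)
  refine (measure_mono fun x hx => ?_).trans key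
  rw [Set.mem_ofPred_eq] at hx ⊢
  refine fun hall => hx ?_
  simp only [← hrdef, ← hsdef] at hall
  obtain ⟨S, hScard, hS⟩ := exists_finset_sum_inner_sq_le _ (by positivity) (by positivity) hall
  -- With t = β = k/2000 the discarded fraction is at most 24 (1/1000 + 4/10000 + 1/2000 +
  -- 4/20000000) < 0.046. If D = 0, the quotients are 0 by convention.
  have hcard : 0.95 * (k : ℝ) ≤ #S := by
    refine le_trans ?_ hScard
    rw [Fintype.card_fin, ← hmdef, hmq]
    have h1 : s / (20000000 * D) ≤ 1 / 20000000 := by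
      rcases hD0.eq_or_lt with h | h
      · rw [← h]; norm_num
      · rw [div_le_div_iff₀ (by positivity) (by norm_num)]; linarith
    have h2 : r / (k / 2000 * (20000000 * D)) ≤ 1 / 10000 := by
      rcases hD0.eq_or_lt with h | h
      · rw [← h]; norm_num
      · rw [div_le_div_iff₀ (by positivity) (by norm_num)]
        have : r / k * k = r := by field_simp
        nlinarith
    have h3 := mul_le_mul_of_nonneg_left h1 hk0.le
    have h4 := mul_le_mul_of_nonneg_left h2 hk0.le
    linarith
  refine ⟨S.val.map (bucketMean k x), Multiset.map_le_map (Finset.val_le_iff.2 S.subset_univ),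
    by simpa using hcard, ?_⟩
  refine isStableSet_of_sum_inner_sq_le hk hcard (q := q) ?_ (by positivity) ?_ ?_
  · simpa using hS
  · linarith [Real.sqrt_nonneg (stableRank (covMat P) / k)]
  · rw [hq2]
    have hst : 0 ≤ stableRank (covMat P) / k := by
      rw [stableRank]; positivity
    have h1 : stableRank (covMat P) / k + 1 ≤ (√(stableRank (covMat P) / k) + 1) ^ 2 := by
      nlinarith [Real.sq_sqrt hst, Real.sqrt_nonneg (stableRank (covMat P) / k)]
    have h2 : s * (stableRank (covMat P) / k + 1) = D := by
      rw [stableRank, ← hsdef, ← hrdef, hD]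
      rcases hs0.eq_or_lt with h | h
      · simp [← h, hsr h.symm]
      · field_simp
        ring
    have h3 : D ≤ s * (√(stableRank (covMat P) / k) + 1) ^ 2 := by
      rw [← h2]; gcongr
    have h4 : D / m ≤ 2 * k * D / n := by
      rw [div_le_div_iff₀ hm0 hn0]
      nlinarith
    -- n ≤ 2km replaces 1/m by 2k/n; the final 400000000 is 20000².
    calc 5 * (20000000 * D / m) = 100000000 * (D / m) := by ring
      _ ≤ 100000000 * (2 * k * D / n) := by gcongr
      _ = k / n * 200000000 * D := by ring
      _ ≤ k / n * 400000000 * (s * (√(stableRank (covMat P) / k) + 1) ^ 2) := by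
        gcongr
        norm_num
      _ = _ := by ring

end Main

/-- `K` and `C` are absolute constants. `X` is the i.i.d. sample from `P`; `T` lists, in an
arbitrary order, the points of the corrupted sample, and both the points and the order may depend
on `X` and on further randomness; `π` is the shuffle used for random bucketing. The last line
bounds the outer probability of the failure event, so no measurability of that event is
presupposed. -/
theorem theorem1p6 :
    ∃ K C : ℝ, 0 < K ∧ 0 < C ∧
      ∀ (d n : ℕ) (Ω : Type*) [MeasurableSpace Ω] (Pr : Measure Ω) [IsProbabilityMeasure Pr]
        (P : Measure (Vec d)) [IsProbabilityMeasure P]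
        (X : Fin n → Ω → Vec d) (T : Ω → Fin n → Vec d) (π : Ω → Equiv.Perm (Fin n))
        (ε ε' τ : ℝ) (k : ℕ),
        MemLp id 2 P →
        (∀ i, Measurable (X i)) → (∀ i, HasLaw (X i) P Pr) → iIndepFun X Pr →
        0 ≤ ε → 0 < τ → τ < 1 →
        Measurable T →
        (∀ᵐ ω ∂Pr, IsCorruption ε (toMultiset fun i => X i ω) (toMultiset (T ω))) →
        Measurable π → HasLaw π (uniformOn Set.univ) Pr →
        IndepFun π (fun ω => ((fun i => X i ω), T ω)) Pr →
        K * (ε + Real.log (1 / τ) / n) ≤ ε' → ε' ≤ 1 →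
        k = ⌊ε' * n⌋₊ → 1 ≤ k →
        Pr {ω | ¬ ∃ S S' : Multiset (Vec d),
            IsCorruption 0.01 S (momPreprocess k (T ω) (π ω)) ∧
            S' ≤ S ∧ 0.95 * (k : ℝ) ≤ (S'.card : ℝ) ∧
            IsStableSet 0.1 (C * (Real.sqrt (stableRank (covMat P) / k) + 1))
              (∫ x, x ∂P) (k * specNorm (covMat P) / n) S'} ≤ ENNReal.ofReal τ := by

  refine ⟨4000, 20000, by norm_num, by norm_num, ?_⟩
  intro d n Ω _ Pr _ P _ X T π ε ε' τ k hP hX hlaw hind hε hτ0 _ hT hcor hπ hπu hπV hK hε' hk hk1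
  have hk0 : (1 : ℝ) ≤ k := by exact_mod_cast hk1
  have hn : 0 < n := by
    rcases Nat.eq_zero_or_pos n with h | h
    · simp [h] at hk
      omega
    · exact h
  have hn0 : (0 : ℝ) < n := by exact_mod_cast hn
  have hlog : 0 ≤ Real.log (1 / τ) := Real.log_nonneg (by rw [le_div_iff₀ hτ0]; linarith)
  have hε'0 : 0 ≤ ε' := le_trans (by positivity) hK
  have hkn : k ≤ n := by
    rw [hk]
    exact Nat.floor_le_of_le (mul_le_of_le_one_left hn0.le hε')
  have hlt : ε' * n < k + 1 := by rw [hk]; exact Nat.lt_floor_add_one _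
  -- Undoing the floor costs a factor 2: ε' n < k + 1 ≤ 2k. Hence ε n ≤ k/2000 ≤ 0.01 k and exp
  -- (-k/2000) ≤ τ.
  have hmain : 4000 * (ε * n + Real.log (1 / τ)) ≤ 2 * k := by
    have h1 := mul_le_mul_of_nonneg_right hK hn0.le
    have h2 : 4000 * (ε + Real.log (1 / τ) / n) * n = 4000 * (ε * n + Real.log (1 / τ)) := by
      field_simp
    linarith
  have hεn : 0 ≤ ε * n := by positivity
  have hred := measure_corrupted_le (k := k) (η := 0.01) hX hlaw hind hT hcor hπ hπu hπV
    (by linarith)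
    (fun S => ∃ S' ≤ S, 0.95 * (k : ℝ) ≤ S'.card ∧
      IsStableSet 0.1 (20000 * (Real.sqrt (stableRank (covMat P) / k) + 1)) (∫ x, x ∂P)
        (k * specNorm (covMat P) / n) S')
  refine le_trans (measure_mono fun ω hω => ?_)
    ((hred.trans (measure_not_exists_stable_le hP hk1 hkn)).trans (ENNReal.ofReal_le_ofReal ?_))
  · rw [Set.mem_ofPred_eq] at hω ⊢
    rintro ⟨S, hS, S', hS', hcard, hst⟩
    exact hω ⟨S, S', hS, hS', hcard, hst⟩
  · rw [one_div, Real.log_inv] at hmain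
    rw [← Real.le_log_iff_exp_le hτ0]
    linarith
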